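/- Let $\Omega\subset\mathbb R^d$, $d\in\{2,3\}$, be a polygonal/polyhedral domain (open, connected, equal to the interior of its closure) with a conforming partition $\mathcal T_h$ into finitely many non-overlapping non-degenerate simplices. Let $\partial\Omega=\bar\Gamma_D\cup\bar\Gamma_N$ with $\Gamma_D\cap\Gamma_N=\emptyset$ and $\Gamma_D\neq\emptyset$, each boundary facet having its relative interior contained in $\Gamma_D$ (Dirichlet facet) or in $\Gamma_N$ (Neumann facet). Let $f\in L^2(\Omega)$, $g_D\in C(\Gamma_D)\cap L^2(\Gamma_D)$, $g_N\in L^2(\Gamma_N)$, let $\nu>0$ be constant in each element, and let $\tau$ be a measurable stabilization function on the element boundaries (possibly double-valued on interior facets) with $0<c\le\tau\le C$. Fix $p\ge 0$; $\mathbb P^p$ denotes polynomials of total degree at most $p$, $\Pi_K^p$ and $\Pi_e^p$ are the $L^2(K)$- and $L^2(e)$-orthogonal projections onto $\mathbb P^p(K)$ and $\mathbb P^p(e)$, and $n$ is the outward unit normal. Let $(u_h,q_h)$, with $u_h|_K\in\mathbb P^p(K)$ and $q_h|_K\in[\mathbb P^p(K)]^d$, be an HDG approximation: for every $K\in\mathcal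 T_h$, $$(\nu^{-1}q_h,v)_K-(u_h,\nabla\cdot v)_K+\langle\widehat u_h,v\cdot n\rangle_{\partial K}=0\quad\forall v\in[\mathbb P^p(K)]^d,$$ $$-(q_h,\nabla w)_K+\langle\widehat q_h\cdot n,w\rangle_{\partial K}=(f,w)_K\quad\forall w\in\mathbb P^p(K),$$ where on an interior facet shared by $K^+$ and $K^-$, with the superscripts $\pm$ denoting traces from $K^\pm$, $$\widehat u_h=\tfrac{\tau^+u_h^++\tau^-u_h^-+q_h^+\cdot n^++q_h^-\cdot n^-}{\tau^++\tau^-},\qquad \widehat q_h=\tfrac{\tau^-q_h^++\tau^+q_h^-+\tau^+\tau^-(u_h^+n^++u_h^-n^-)}{\tau^++\tau^-},$$ on Dirichlet facets $\widehat u_h=\Pi_e^pg_D$ and $\widehat q_h\cdot n=q_h\cdot n+\tau(u_h-\Pi_e^pg_D)$, and on Neumann facets $\widehat q_h\cdot n=\Pi_e^pg_N$ and $\widehat u_h=u_h+\tau^{-1}(q_h\cdot n-\Pi_e^pg_N)$. Let $\tilde q_h^\pi$ be the post-processed flux: for each $K\in\mathcal T_h$, $\tilde q_h^\pi|_K\in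 RT^p(K)=[\mathbb P^p(K)]^d+x\,\mathbb P^p(K)$ satisfies $$\langle(\tilde q_h^\pi-\widehat q_h)\cdot n,\mu\rangle_e=0\quad\forall\mu\in\mathbb P^p(e),\ \text{for every facet } e \text{ of } K,$$ $$(\tilde q_h^\pi-q_h,v)_K=0\quad\forall v\in[\mathbb P^{p-1}(K)]^d\quad(\text{if }p\ge1).$$ Then $\tilde q_h^\pi$ satisfies the projected equilibration conditions with both degrees equal to $p$: $\tilde q_h^\pi\in H(\mathrm{div};\Omega)$; $\nabla\cdot\tilde q_h^\pi|_K=\Pi_K^pf$ for every $K\in\mathcal T_h$; and $\tilde q_h^\pi\cdot n|_e=\Pi_e^pg_N$ for every Neumann facet $e$. -/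

import Mathlib

open MeasureTheory
open scoped RealInnerProductSpace ContDiff

namespace HDG

/-- The Euclidean space `ℝ^d`. -/
abbrev Pt (d : ℕ) : Type := EuclideanSpace ℝ (Fin d)

/-! ### Polynomials -/

/-- `f ∈ ℙ^p`: a real polynomial function of total degree at most `p` in `d` variables.
Elements of `ℙ^p(K)` and `ℙ^p(e)` are the restrictions of such functions. -/
def IsPoly {d : ℕ} (p : ℕ) (f : Pt d → ℝ) : Prop :=
  ∃ P : MvPolynomial (Fin d) ℝ, P.totalDegree ≤ p ∧ ∀ x : Pt d, f x = MvPolynomial.eval (fun k => x k) P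

/-- `v ∈ [ℙ^p]^d`. -/
def IsPolyVec {d : ℕ} (p : ℕ) (v : Pt d → Pt d) : Prop :=
  ∀ k : Fin d, IsPoly p (fun x => v x k)

/-- `v ∈ RT^p = [ℙ^p]^d + x ℙ^p`. -/
def IsRaviartThomas {d : ℕ} (p : ℕ) (v : Pt d → Pt d) : Prop :=
  ∃ (a : Pt d → Pt d) (s : Pt d → ℝ), IsPolyVec p a ∧ IsPoly p s ∧ ∀ x, v x = a x + s x • x

/-- The classical divergence `∑ₖ ∂ₖ vₖ`. -/
noncomputable def divergence {d : ℕ} (v : Pt d → Pt d) (x : Pt d) : ℝ :=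
  ∑ k : Fin d, fderiv ℝ v x (EuclideanSpace.single k 1) k

/-! ### `L²`-orthogonal projection onto polynomials -/

/-- `π` is the orthogonal projection in `L²(μ)` of `g` onto `ℙ^p`. -/
def IsL2Proj {d : ℕ} (μ : Measure (Pt d)) (p : ℕ) (g π : Pt d → ℝ) : Prop :=
  IsPoly p π ∧ ∀ w : Pt d → ℝ, IsPoly p w → ∫ x, (g x - π x) * w x ∂μ = 0

open Classical in
/-- The orthogonal projection in `L²(μ)` of `g` onto `ℙ^p`. It exists for `g ∈ L²(μ)` and is unique
`μ`-almost everywhere, see `l2Proj_spec` and `IsL2Proj.ae_eq`. -/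
noncomputable def l2Proj {d : ℕ} (μ : Measure (Pt d)) (p : ℕ) (g : Pt d → ℝ) : Pt d → ℝ :=
  if h : ∃ π, IsL2Proj μ p g π then h.choose else 0

theorem l2Proj_spec {d : ℕ} (μ : Measure (Pt d)) (p : ℕ) (g : Pt d → ℝ)
    (hμ : ∀ w : Pt d → ℝ, IsPoly p w → MemLp w 2 μ) (hg : MemLp g 2 μ) :
    IsL2Proj μ p g (l2Proj μ p g) := by
  have key : ∃ π, IsL2Proj μ p g π := by
    have hP : ∀ P : MvPolynomial.restrictTotalDegree (Fin d) ℝ p,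
        IsPoly p (fun x : Pt d => MvPolynomial.eval (fun k => x k) P.1) := fun P =>
      ⟨P.1, (MvPolynomial.mem_restrictTotalDegree _ _ _).1 P.2, fun _ => rfl⟩
    let T : MvPolynomial.restrictTotalDegree (Fin d) ℝ p →ₗ[ℝ] Lp ℝ 2 μ :=
      { toFun := fun P => (hμ _ (hP P)).toLp _
        map_add' := by
          intro P Q
          rw [← MemLp.toLp_add]
          congr 1
          ext x
          simp
        map_smul' := by
          intro c P
          rw [RingHom.id_apply, ← MemLp.toLp_const_smul]
          congr 1
          ext x
          simp }
    let S := LinearMap.range T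
    obtain ⟨P, hPy⟩ : S.starProjection (hg.toLp g) ∈ LinearMap.range T :=
      Submodule.starProjection_apply_mem S _
    refine ⟨fun x => MvPolynomial.eval (fun k => x k) P.1, hP P, fun w hw => ?_⟩
    obtain ⟨Q, hQ, hwQ⟩ := hw
    let Q' : MvPolynomial.restrictTotalDegree (Fin d) ℝ p :=
      ⟨Q, (MvPolynomial.mem_restrictTotalDegree _ _ _).2 hQ⟩
    have hw : w = fun x => MvPolynomial.eval (fun k => x k) Q'.1 := funext hwQ
    have h0 : inner ℝ (hg.toLp g - S.starProjection (hg.toLp g)) (T Q') = 0 :=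
      Submodule.starProjection_inner_eq_zero _ _ ⟨Q', rfl⟩
    rw [← hPy, L2.inner_def] at h0
    rw [← h0]
    apply integral_congr_ae
    filter_upwards [Lp.coeFn_sub (hg.toLp g) (T P), hg.coeFn_toLp,
      (hμ _ (hP P)).coeFn_toLp, (hμ _ (hP Q')).coeFn_toLp] with x h1 h2 h3 h4
    have h3' : (T P : Pt d → ℝ) x = MvPolynomial.eval (fun k => x k) P.1 := h3
    have h4' : (T Q' : Pt d → ℝ) x = MvPolynomial.eval (fun k => x k) Q'.1 := h4
    rw [h1, h4', Pi.sub_apply, h2, h3', hw]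
    simp [mul_comm]
  unfold l2Proj
  rw [dif_pos key]
  exact key.choose_spec

theorem IsL2Proj.ae_eq {d : ℕ} {μ : Measure (Pt d)} {p : ℕ} {g π₁ π₂ : Pt d → ℝ}
    (hμ : ∀ w : Pt d → ℝ, IsPoly p w → MemLp w 2 μ) (hg : MemLp g 2 μ)
    (h₁ : IsL2Proj μ p g π₁) (h₂ : IsL2Proj μ p g π₂) : π₁ =ᵐ[μ] π₂ := by
  have hd : IsPoly p (fun x => π₁ x - π₂ x) := by
    obtain ⟨P, hP, hP'⟩ := h₁.1
    obtain ⟨Q, hQ, hQ'⟩ := h₂.1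
    refine ⟨P - Q, (MvPolynomial.totalDegree_sub _ _).trans (max_le hP hQ), fun x => ?_⟩
    simp [hP', hQ']
  have i₁ : Integrable (fun x => (g x - π₁ x) * (π₁ x - π₂ x)) μ :=
    (hg.sub (hμ _ h₁.1)).integrable_mul (hμ _ hd)
  have i₂ : Integrable (fun x => (g x - π₂ x) * (π₁ x - π₂ x)) μ :=
    (hg.sub (hμ _ h₂.1)).integrable_mul (hμ _ hd)
  have i₃ : Integrable (fun x => (π₁ x - π₂ x) * (π₁ x - π₂ x)) μ :=
    (hμ _ hd).integrable_mul (hμ _ hd)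
  have h0 : ∫ x, (π₁ x - π₂ x) * (π₁ x - π₂ x) ∂μ = 0 := by
    have := integral_sub i₂ i₁
    rw [h₁.2 _ hd, h₂.2 _ hd, sub_zero] at this
    rw [← this]
    congr 1
    ext x
    ring
  rw [integral_eq_zero_iff_of_nonneg (fun x => mul_self_nonneg _) i₃] at h0
  filter_upwards [h0] with x hx
  have : π₁ x - π₂ x = 0 := mul_self_eq_zero.1 hx
  linarith

/-! ### `H(div; Ω)` -/

/-- `g ∈ L²(Ω)` is the weak divergence of `v` in the open set `Ω`. -/
def HasWeakDiv {d : ℕ} (Ω : Set (Pt d)) (v : Pt d → Pt d) (g : Pt d → ℝ) : Prop :=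
  MemLp g 2 (volume.restrict Ω) ∧
    ∀ φ : Pt d → ℝ, ContDiff ℝ ∞ φ → HasCompactSupport φ → tsupport φ ⊆ Ω →
      ∫ x in Ω, ⟪v x, gradient φ x⟫ = -∫ x in Ω, g x * φ x

/-- `v ∈ H(div; Ω)`. -/
def MemHDiv {d : ℕ} (Ω : Set (Pt d)) (v : Pt d → Pt d) : Prop :=
  MemLp v 2 (volume.restrict Ω) ∧ ∃ g, HasWeakDiv Ω v g

/-! ### Simplicial meshes -/

section Mesh

variable {d : ℕ} [NeZero d] {ι : Type*}

/-- The (closed) facet of a simplex opposite to its `j`-th vertex. -/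
def facet (s : Affine.Simplex ℝ (Pt d) d) (j : Fin (d + 1)) : Set (Pt d) :=
  (s.faceOpposite j).closedInterior

/-- The facet without its relative boundary. -/
def openFacet (s : Affine.Simplex ℝ (Pt d) d) (j : Fin (d + 1)) : Set (Pt d) :=
  (s.faceOpposite j).interior

/-- The `(d-1)`-dimensional surface measure in `ℝ^d`, normalised to agree with Lebesgue measure on
hyperplanes. -/
noncomputable def surf (d : ℕ) : Measure (Pt d) := Measure.euclideanHausdorffMeasure (d - 1)

/-- The unit normal on the facet opposite to the vertex `j`, pointing out of the simplex: the
direction from the vertex `j` to the foot of its altitude. -/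
noncomputable def normal (s : Affine.Simplex ℝ (Pt d) d) (j : Fin (d + 1)) : Pt d :=
  ‖s.altitudeFoot j - s.points j‖⁻¹ • (s.altitudeFoot j - s.points j)

theorem norm_normal (s : Affine.Simplex ℝ (Pt d) d) (j : Fin (d + 1)) : ‖normal s j‖ = 1 := by
  have h : s.altitudeFoot j - s.points j ≠ 0 := sub_ne_zero.2 (s.ne_altitudeFoot j).symm
  rw [normal, norm_smul, norm_inv, norm_norm, inv_mul_cancel₀ (norm_ne_zero_iff.2 h)]

/-- `K` is a conforming mesh of `Ω` by non-overlapping non-degenerate simplices: two distinct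
elements meet in the convex hull of their common vertices (the empty set or a common face). -/
structure IsMesh (Ω : Set (Pt d)) (K : ι → Affine.Simplex ℝ (Pt d) d) : Prop where
  cover : ⋃ i, (K i).closedInterior = closure Ω
  nonoverlapping : ∀ i i', i ≠ i' → Disjoint (K i).interior (K i').interior
  conforming : ∀ i i', i ≠ i' → (K i).closedInterior ∩ (K i').closedInterior =
    convexHull ℝ (Set.range (K i).points ∩ Set.range (K i').points)

/-- The facet `j` of `K i` and the facet `j'` of `K i'` are the two sides of one interior facet. -/
def IsInteriorFacet (K : ι → Affine.Simplex ℝ (Pt d) d) (i : ι) (j : Fin (d + 1)) (i' : ι)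
    (j' : Fin (d + 1)) : Prop :=
  i ≠ i' ∧ facet (K i) j = facet (K i') j'

/-- The facet lies on `∂Ω` and belongs to the part `Γ` of `∂Ω`. -/
def IsBoundaryFacet (Ω Γ : Set (Pt d)) (s : Affine.Simplex ℝ (Pt d) d) (j : Fin (d + 1)) : Prop :=
  facet s j ⊆ frontier Ω ∧ openFacet s j ⊆ Γ

/-- `∂Ω` is divided into the disjoint parts `Γ_D` (non-empty) and `Γ_N`, and each boundary facet of
the mesh belongs to one of them. -/
structure IsBoundarySplit (Ω ΓD ΓN : Set (Pt d)) (K : ι → Affine.Simplex ℝ (Pt d) d) : Prop where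
  closure_union : closure ΓD ∪ closure ΓN = frontier Ω
  disjoint : Disjoint ΓD ΓN
  nonempty : ΓD.Nonempty
  resolved : ∀ i j, facet (K i) j ⊆ frontier Ω →
    IsBoundaryFacet Ω ΓD (K i) j ∨ IsBoundaryFacet Ω ΓN (K i) j

/-- The field on `Ω` whose restriction to the interior of each element `K i` is `σ i`
(extended by zero to the null set of the remaining points). -/
noncomputable def glue [Fintype ι] (K : ι → Affine.Simplex ℝ (Pt d) d) (σ : ι → Pt d → Pt d) :
    Pt d → Pt d :=
  fun x => ∑ i, (K i).interior.indicator (σ i) x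

/-- The projection `Π_K^p g`. -/
noncomputable def projElt (s : Affine.Simplex ℝ (Pt d) d) (p : ℕ) (g : Pt d → ℝ) : Pt d → ℝ :=
  l2Proj (volume.restrict s.closedInterior) p g

/-- The projection `Π_e^p g`, `e` being the facet of `s` opposite to the vertex `j`. -/
noncomputable def projFacet (s : Affine.Simplex ℝ (Pt d) d) (j : Fin (d + 1)) (p : ℕ)
    (g : Pt d → ℝ) : Pt d → ℝ :=
  l2Proj ((surf d).restrict (facet s j)) p g

/-! ### The HDG method -/

/-- The HDG equations of order `p`. The broken polynomial functions `u_h` and `q_h` are given by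
their polynomial restrictions `u i`, `q i` to the elements `K i`, which also give the traces from
inside `K i`. The stabilization function on facet `j` of `K i` is `τ i j`, and `uhat i j`, `qhat i j`
are the numerical traces there (on boundary facets only the normal component of `qhat` matters). -/
structure IsHDGSolution (Ω ΓD ΓN : Set (Pt d)) (K : ι → Affine.Simplex ℝ (Pt d) d) (p : ℕ)
    (ν f gD gN : Pt d → ℝ) (τ : ι → Fin (d + 1) → Pt d → ℝ)
    (u : ι → Pt d → ℝ) (q : ι → Pt d → Pt d)
    (uhat : ι → Fin (d + 1) → Pt d → ℝ) (qhat : ι → Fin (d + 1) → Pt d → Pt d) : Prop where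
  u_poly : ∀ i, IsPoly p (u i)
  q_poly : ∀ i, IsPolyVec p (q i)
  uhat_interior : ∀ i j i' j', IsInteriorFacet K i j i' j' → ∀ x ∈ facet (K i) j,
    uhat i j x = τ i j x / (τ i j x + τ i' j' x) * u i x
      + τ i' j' x / (τ i j x + τ i' j' x) * u i' x
      + 1 / (τ i j x + τ i' j' x) * (⟪q i x, normal (K i) j⟫ + ⟪q i' x, normal (K i') j'⟫)
  qhat_interior : ∀ i j i' j', IsInteriorFacet K i j i' j' → ∀ x ∈ facet (K i) j,
    qhat i j x = (τ i' j' x / (τ i j x + τ i' j' x)) • q i x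
      + (τ i j x / (τ i j x + τ i' j' x)) • q i' x
      + (τ i j x * τ i' j' x / (τ i j x + τ i' j' x)) •
        (u i x • normal (K i) j + u i' x • normal (K i') j')
  uhat_dirichlet : ∀ i j, IsBoundaryFacet Ω ΓD (K i) j → ∀ x ∈ facet (K i) j,
    uhat i j x = projFacet (K i) j p gD x
  qhat_dirichlet : ∀ i j, IsBoundaryFacet Ω ΓD (K i) j → ∀ x ∈ facet (K i) j,
    ⟪qhat i j x, normal (K i) j⟫ =
      ⟪q i x, normal (K i) j⟫ + τ i j x * (u i x - projFacet (K i) j p gD x)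
  qhat_neumann : ∀ i j, IsBoundaryFacet Ω ΓN (K i) j → ∀ x ∈ facet (K i) j,
    ⟪qhat i j x, normal (K i) j⟫ = projFacet (K i) j p gN x
  uhat_neumann : ∀ i j, IsBoundaryFacet Ω ΓN (K i) j → ∀ x ∈ facet (K i) j,
    uhat i j x = u i x + 1 / τ i j x * (⟪q i x, normal (K i) j⟫ - projFacet (K i) j p gN x)
  eq_flux : ∀ i, ∀ v : Pt d → Pt d, IsPolyVec p v →
    (∫ x in (K i).closedInterior, (ν x)⁻¹ * ⟪q i x, v x⟫)
      - (∫ x in (K i).closedInterior, u i x * divergence v x)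
      + ∑ j, ∫ x in facet (K i) j, uhat i j x * ⟪v x, normal (K i) j⟫ ∂(surf d) = 0
  eq_balance : ∀ i, ∀ w : Pt d → ℝ, IsPoly p w →
    -(∫ x in (K i).closedInterior, ⟪q i x, gradient w x⟫)
      + ∑ j, ∫ x in facet (K i) j, ⟪qhat i j x, normal (K i) j⟫ * w x ∂(surf d)
      = ∫ x in (K i).closedInterior, f x * w x

/-- The elementwise Raviart–Thomas post-processing `σ` of the HDG flux `q_h` and of its numerical
trace `qhat`. -/
structure IsPostprocessedFlux (K : ι → Affine.Simplex ℝ (Pt d) d) (p : ℕ) (q : ι → Pt d → Pt d)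
    (qhat : ι → Fin (d + 1) → Pt d → Pt d) (σ : ι → Pt d → Pt d) : Prop where
  raviartThomas : ∀ i, IsRaviartThomas p (σ i)
  facet_moments : ∀ i j, ∀ μ : Pt d → ℝ, IsPoly p μ →
    ∫ x in facet (K i) j, ⟪σ i x - qhat i j x, normal (K i) j⟫ * μ x ∂(surf d) = 0
  element_moments : 1 ≤ p → ∀ i, ∀ v : Pt d → Pt d, IsPolyVec (p - 1) v →
    ∫ x in (K i).closedInterior, ⟪σ i x - q i x, v x⟫ = 0

/-- The field with restrictions `σ i` to the elements is a projected equilibrated flux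
reconstruction associated with the pair of degrees `(a, b)`. -/
structure IsProjectedEquilibratedFlux [Fintype ι] (Ω ΓN : Set (Pt d))
    (K : ι → Affine.Simplex ℝ (Pt d) d) (f gN : Pt d → ℝ) (a b : ℕ) (σ : ι → Pt d → Pt d) :
    Prop where
  mem_hdiv : MemHDiv Ω (glue K σ)
  div_eq : ∀ g, HasWeakDiv Ω (glue K σ) g → ∀ i,
    g =ᵐ[volume.restrict (K i).closedInterior] projElt (K i) a f
  normal_eq : ∀ i j, IsBoundaryFacet Ω ΓN (K i) j → ∀ x ∈ facet (K i) j,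
    ⟪σ i x, normal (K i) j⟫ = projFacet (K i) j b gN x

end Mesh

end HDG

open HDG

namespace HDG

set_option linter.unusedSectionVars false

/-! On the plane of a facet `x · n` is constant, so the normal component of a field in `RT^p` is
there a polynomial of degree `p` (`IsRaviartThomas.exists_isPoly_inner`). Its facet moments against
`ℙ^p` therefore determine it. The numerical flux is single-valued and the two outward normals of an
interior facet are opposite, so the normal jump of the post-processed flux is a polynomial
orthogonal to all of `ℙ^p`, hence zero. In the same way its normal component on a Neumann facet
equals the projected datum.

For the divergence, integrate by parts on one element against `w ∈ ℙ^p`. The facet moments replace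
`σ · n` by the numerical flux, and the element moments replace `σ` by `q` in the volume term,
because `∇w` has degree `p - 1` (and vanishes for `p = 0`). What remains is the balance equation of
the method, so `div σ` has the moments of `f`. Being in `ℙ^p`, it is the projection of `f`.

Summing the integration by parts over all elements against a test function supported in `Ω`,
interior facets cancel in pairs and boundary facets contribute nothing. Hence the piecewise
divergence is the weak one (`IsMesh.hasWeakDiv_glue`).

Two tools carry this. The divergence theorem on a simplex, with Hausdorff surface measure, comes
from Fubini along edges (`integral_fderiv_edge`) and linearity in the direction. The combinatorics
of the mesh (`IsMesh.exists_isInteriorFacet`, `IsMesh.interiorFacet_unique`,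
`normal_eq_neg_of_facet_eq`) is read off from signs of barycentric coordinates. -/

/-- The hyperplane through `a` orthogonal to `n`. -/
def hyperplane {d : ℕ} (n a : Pt d) : Set (Pt d) := {x | ⟪n, x - a⟫ = 0}

/-! ### Simplices in barycentric coordinates -/

section SimplexGeometry

variable {d : ℕ} [NeZero d]

/-- The vertices of a nondegenerate `d`-simplex in `ℝ^d` as an affine basis. -/
noncomputable def vertexBasis (s : Affine.Simplex ℝ (Pt d) d) :
    AffineBasis (Fin (d + 1)) ℝ (Pt d) :=
  ⟨s.points, s.independent,
    (s.independent.affineSpan_eq_top_iff_card_eq_finrank_add_one).2 (by simp)⟩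

/-- The barycentric coordinate of a simplex belonging to the `j`-th vertex. -/
noncomputable def bary (s : Affine.Simplex ℝ (Pt d) d) (j : Fin (d + 1)) : Pt d →ᵃ[ℝ] ℝ :=
  (vertexBasis s).coord j

/-- The distance of the `j`-th vertex to the opposite facet. -/
noncomputable def alt (s : Affine.Simplex ℝ (Pt d) d) (j : Fin (d + 1)) : ℝ :=
  ‖s.altitudeFoot j - s.points j‖

variable (s : Affine.Simplex ℝ (Pt d) d)

theorem bary_point_self (j : Fin (d + 1)) : bary s j (s.points j) = 1 :=
  (vertexBasis s).coord_apply_eq j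

theorem bary_point_ne {j k : Fin (d + 1)} (h : j ≠ k) : bary s j (s.points k) = 0 :=
  (vertexBasis s).coord_apply_ne h

theorem sum_bary (x : Pt d) : ∑ j, bary s j x = 1 :=
  (vertexBasis s).sum_coord_apply_eq_one x

theorem affineCombination_bary (x : Pt d) :
    Finset.univ.affineCombination ℝ s.points (fun j => bary s j x) = x :=
  (vertexBasis s).affineCombination_coord_eq_self x

theorem continuous_bary (j : Fin (d + 1)) : Continuous (bary s j) :=
  continuous_barycentric_coord (vertexBasis s) j

theorem bary_affineCombination {w : Fin (d + 1) → ℝ} (hw : ∑ j, w j = 1) (j : Fin (d + 1)) :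
    bary s j (Finset.univ.affineCombination ℝ s.points w) = w j :=
  (vertexBasis s).coord_apply_combination_of_mem (Finset.mem_univ j) hw

theorem bary_add (j : Fin (d + 1)) (x v : Pt d) :
    bary s j (x + v) = bary s j x + (bary s j).linear v := by
  have := (bary s j).map_vadd x v
  simp only [vadd_eq_add] at this
  rw [add_comm x v, this, add_comm]

theorem bary_linear_sub (j : Fin (d + 1)) (x y : Pt d) :
    (bary s j).linear (x - y) = bary s j x - bary s j y :=
  (bary s j).linearMap_vsub x y

theorem mem_closedInterior_iff {x : Pt d} :
    x ∈ s.closedInterior ↔ ∀ j, 0 ≤ bary s j x := by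
  rw [← s.convexHull_eq_closedInterior]
  have := (vertexBasis s).convexHull_eq_nonneg_coord
  exact Set.ext_iff.1 this x

theorem mem_interior_iff {x : Pt d} : x ∈ s.interior ↔ ∀ j, 0 < bary s j x := by
  conv_lhs => rw [← affineCombination_bary s x]
  rw [Affine.Simplex.affineCombination_mem_interior_iff (sum_bary s x)]
  -- The upper bound `< 1` is automatic: `d ≥ 1` provides a second index, whose positive coordinate
  -- takes part of the total 1.
  refine ⟨fun h j => (h j).1, fun h j => ⟨h j, ?_⟩⟩
  obtain ⟨k, hk⟩ : ∃ k, k ≠ j := exists_ne j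
  rw [← sum_bary s x]
  exact Finset.single_lt_sum hk (Finset.mem_univ j) (Finset.mem_univ k) (h k)
    fun i _ _ => (h i).le

theorem interior_closedInterior : interior s.closedInterior = s.interior := by
  rw [← s.convexHull_eq_closedInterior]
  refine (vertexBasis s).interior_convexHull.trans ?_
  ext x
  exact (mem_interior_iff s).symm

theorem isOpen_simplexInterior : IsOpen s.interior := by
  rw [← interior_closedInterior]; exact isOpen_interior

theorem convex_closedInterior : Convex ℝ s.closedInterior := by
  rw [← s.convexHull_eq_closedInterior]; exact convex_convexHull _ _

theorem closedInterior_ae_eq_interior :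
    s.interior =ᵐ[volume] s.closedInterior := by
  rw [← interior_closedInterior]
  exact interior_ae_eq_of_null_frontier ((convex_closedInterior s).addHaar_frontier volume)

theorem mem_facet_iff {j : Fin (d + 1)} {x : Pt d} :
    x ∈ facet s j ↔ bary s j x = 0 ∧ ∀ k, 0 ≤ bary s k x := by
  conv_lhs => rw [← affineCombination_bary s x]
  unfold facet Affine.Simplex.faceOpposite
  rw [Affine.Simplex.affineCombination_mem_closedInterior_face_iff_nonneg _ _ (sum_bary s x)]
  simp only [Finset.mem_compl, Finset.mem_singleton, not_not, forall_eq]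
  constructor
  · rintro ⟨h1, h2⟩
    refine ⟨h2, fun k => ?_⟩
    by_cases hk : k = j
    · rw [hk, h2]
    · exact h1 k hk
  · rintro ⟨h1, h2⟩
    exact ⟨fun k _ => h2 k, h1⟩

theorem facet_subset_closedInterior (j : Fin (d + 1)) : facet s j ⊆ s.closedInterior :=
  fun _ hx => (mem_closedInterior_iff s).2 ((mem_facet_iff s).1 hx).2

theorem facet_injective {j k : Fin (d + 1)} (h : facet s j = facet s k) : j = k := by
  by_contra hjk
  have h1 : s.points k ∈ facet s j := by
    refine (mem_facet_iff s).2 ⟨bary_point_ne s hjk, fun i => ?_⟩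
    by_cases hik : i = k
    · rw [hik, bary_point_self]; exact zero_le_one
    · rw [bary_point_ne s hik]
  rw [h] at h1
  have := ((mem_facet_iff s).1 h1).1
  rw [bary_point_self] at this
  exact one_ne_zero this

theorem isCompact_facet (j : Fin (d + 1)) : IsCompact (facet s j) :=
  (s.faceOpposite j).isCompact_closedInterior

theorem alt_pos (j : Fin (d + 1)) : 0 < alt s j :=
  norm_pos_iff.2 (sub_ne_zero.2 (s.ne_altitudeFoot j).symm)

theorem inner_normal_point_ne {j k : Fin (d + 1)} (h : j ≠ k) :
    ⟪normal s j, s.points k - s.altitudeFoot j⟫ = 0 := by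
  have h0 : ⟪s.points k - s.altitudeFoot j, s.points j - s.altitudeFoot j⟫ = 0 :=
    s.inner_vsub_altitudeFoot_vsub_altitudeFoot_eq_zero h
  rw [normal, inner_smul_left, ← neg_sub, inner_neg_left, real_inner_comm, h0]
  simp

theorem inner_normal_point_self (j : Fin (d + 1)) :
    ⟪normal s j, s.points j - s.altitudeFoot j⟫ = -alt s j := by
  rw [normal, inner_smul_left, ← neg_sub (s.altitudeFoot j), inner_neg_right,
    real_inner_self_eq_norm_sq]
  have := (alt_pos s j).ne'
  unfold alt at *
  simp only [conj_trivial]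
  field_simp

/-- Both sides are affine in `x`, so agreement at the vertices suffices. This ties the metric data
(normal, height) to barycentric coordinates, in which the later geometry is computed. -/
theorem inner_normal_sub_foot (j : Fin (d + 1)) (x : Pt d) :
    ⟪normal s j, x - s.altitudeFoot j⟫ = -alt s j * bary s j x := by
  let f : Pt d →ᵃ[ℝ] ℝ :=
    { toFun := fun x => ⟪normal s j, x - s.altitudeFoot j⟫
      linear := (innerSL ℝ (normal s j)).toLinearMap
      map_vadd' := by
        intro p v
        simp only [vadd_eq_add, ContinuousLinearMap.coe_coe, innerSL_apply_apply]
        rw [add_sub_assoc, inner_add_right] }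
  have hfg : f = (-alt s j) • bary s j := by
    refine AffineMap.ext_on (vertexBasis s).tot ?_
    rintro _ ⟨k, rfl⟩
    change ⟪normal s j, s.points k - s.altitudeFoot j⟫ = -alt s j * bary s j (s.points k)
    by_cases h : j = k
    · subst h
      rw [inner_normal_point_self, bary_point_self, mul_one]
    · rw [inner_normal_point_ne s h, bary_point_ne s h, mul_zero]
  exact congrArg (fun g : Pt d →ᵃ[ℝ] ℝ => g x) hfg

theorem inner_normal_eq (j : Fin (d + 1)) (v : Pt d) :
    ⟪normal s j, v⟫ = -alt s j * (bary s j).linear v := by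
  have h := inner_normal_sub_foot s j (s.altitudeFoot j + v)
  have h0 := inner_normal_sub_foot s j (s.altitudeFoot j)
  rw [sub_self, inner_zero_right] at h0
  rw [add_sub_cancel_left, bary_add, mul_add, ← h0, zero_add] at h
  exact h

/-- The hyperplane containing a facet. -/
abbrev facetPlane (j : Fin (d + 1)) : Set (Pt d) :=
  hyperplane (normal s j) (s.altitudeFoot j)

theorem mem_facetPlane_iff {j : Fin (d + 1)} {x : Pt d} :
    x ∈ facetPlane s j ↔ bary s j x = 0 := by
  change ⟪normal s j, x - s.altitudeFoot j⟫ = 0 ↔ _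
  rw [inner_normal_sub_foot, mul_eq_zero]
  simp [(alt_pos s j).ne']

theorem facet_subset_facetPlane (j : Fin (d + 1)) : facet s j ⊆ facetPlane s j :=
  fun _ hx => (mem_facetPlane_iff s).2 ((mem_facet_iff s).1 hx).1

/-- The barycentre of a facet. -/
noncomputable def facetCenter (j : Fin (d + 1)) : Pt d :=
  Finset.univ.affineCombination ℝ s.points (fun k => if k = j then 0 else (d : ℝ)⁻¹)

theorem bary_facetCenter (j k : Fin (d + 1)) :
    bary s k (facetCenter s j) = if k = j then 0 else (d : ℝ)⁻¹ := by
  have hd : (d : ℝ) ≠ 0 := Nat.cast_ne_zero.2 (NeZero.ne d)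
  refine bary_affineCombination s ?_ k
  rw [← Finset.sum_erase_add _ _ (Finset.mem_univ j), if_pos rfl, add_zero,
    Finset.sum_congr rfl (g := fun _ => (d : ℝ)⁻¹)
      (fun k hk => if_neg (Finset.ne_of_mem_erase hk))]
  simp [hd]

theorem bary_facetCenter_pos {j k : Fin (d + 1)} (h : k ≠ j) : 0 < bary s k (facetCenter s j) := by
  rw [bary_facetCenter, if_neg h]
  exact inv_pos.2 (Nat.cast_pos.2 (Nat.pos_of_ne_zero (NeZero.ne d)))

theorem bary_lineMap (k : Fin (d + 1)) (x y : Pt d) (t : ℝ) :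
    bary s k (AffineMap.lineMap x y t) = (1 - t) * bary s k x + t * bary s k y := by
  rw [AffineMap.apply_lineMap, AffineMap.lineMap_apply_module]
  simp

end SimplexGeometry

/-! ### Surface measure on hyperplanes and Fubini along an oblique direction -/

section Hyperplane

variable {d : ℕ} {n : Pt d}

/-- Parametrization of a hyperplane by its direction. -/
def planeParam (n a : Pt d) (w : (ℝ ∙ n)ᗮ) : Pt d := a + w

theorem isometry_planeParam (n a : Pt d) : Isometry (planeParam n a) :=
  (isometry_add_left a).comp isometry_subtype_coe

theorem range_planeParam (n a : Pt d) : Set.range (planeParam n a) = hyperplane n a := by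
  ext x
  constructor
  · rintro ⟨w, rfl⟩
    have := Submodule.mem_orthogonal_singleton_iff_inner_right.1 w.2
    simpa [hyperplane, planeParam] using this
  · intro hx
    exact ⟨⟨x - a, Submodule.mem_orthogonal_singleton_iff_inner_right.2 hx⟩, by simp [planeParam]⟩

/-- An isometry transports Hausdorff measure, and on the `(d-1)`-dimensional direction space this
measure is Lebesgue measure. -/
theorem surf_restrict_hyperplane (hn : ‖n‖ = 1) (a : Pt d) :
    (surf d).restrict (hyperplane n a) = (volume : Measure (ℝ ∙ n)ᗮ).map (planeParam n a) := by
  have hn0 : n ≠ 0 := by rintro rfl; simp at hn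
  have hfin : Module.finrank ℝ (ℝ ∙ n)ᗮ = d - 1 := by
    have h := (ℝ ∙ n).finrank_add_finrank_orthogonal
    rw [finrank_span_singleton hn0, finrank_euclideanSpace_fin] at h
    omega
  rw [← range_planeParam, surf, ← (isometry_planeParam n a).map_euclideanHausdorffMeasure, ← hfin,
    InnerProductSpace.euclideanHausdorffMeasure_eq_volume]

theorem measurableSet_hyperplane (n a : Pt d) : MeasurableSet (hyperplane n a) := by
  apply IsClosed.measurableSet
  exact isClosed_eq (by fun_prop) continuous_const

theorem sFinite_surf_restrict_hyperplane (hn : ‖n‖ = 1) (a : Pt d) :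
    SFinite ((surf d).restrict (hyperplane n a)) := by
  rw [surf_restrict_hyperplane hn]; infer_instance

theorem surf_lt_top_of_isCompact (hn : ‖n‖ = 1) {a : Pt d} {S : Set (Pt d)} (hS : IsCompact S)
    (hSH : S ⊆ hyperplane n a) : surf d S < ⊤ := by
  have h : surf d S = volume (planeParam n a ⁻¹' S) := by
    rw [← (isometry_planeParam n a).isClosedEmbedding.measurableEmbedding.map_apply,
      ← surf_restrict_hyperplane hn, Measure.restrict_apply hS.measurableSet,
      Set.inter_eq_left.2 hSH]
  rw [h]
  exact ((isometry_planeParam n a).isClosedEmbedding.isCompact_preimage hS).measure_lt_top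

theorem surf_inter_hyperplane_pos (hn : ‖n‖ = 1) {a x : Pt d} {U : Set (Pt d)} (hU : IsOpen U)
    (hx : x ∈ U) (hxa : x ∈ hyperplane n a) : 0 < surf d (U ∩ hyperplane n a) := by
  rw [← Measure.restrict_apply hU.measurableSet, surf_restrict_hyperplane hn,
    (isometry_planeParam n a).isClosedEmbedding.measurableEmbedding.map_apply]
  rw [← range_planeParam] at hxa
  obtain ⟨w, rfl⟩ := hxa
  exact (hU.preimage (isometry_planeParam n a).continuous).measure_pos volume ⟨w, hx⟩

/-- Sweeping a hyperplane along a transversal direction `e` yields Lebesgue measure up to the factor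
`|⟪n, e⟫|`. -/
theorem volume_eq_map_sweep (hn : ‖n‖ = 1) (a e : Pt d) (he : ⟪n, e⟫ ≠ 0) :
    (volume : Measure (Pt d)) = ENNReal.ofReal |⟪n, e⟫| •
      (((surf d).restrict (hyperplane n a)).prod (volume : Measure ℝ)).map
        (fun z : Pt d × ℝ => z.1 + z.2 • e) := by
  set c := ⟪n, e⟫ with hc
  have hperp : e - c • n ∈ (ℝ ∙ n)ᗮ := by
    refine Submodule.mem_orthogonal_singleton_iff_inner_right.2 ?_
    rw [inner_sub_right, inner_smul_right, real_inner_self_eq_norm_sq, hn, ← hc]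
    ring
  let e' : (ℝ ∙ n)ᗮ := ⟨e - c • n, hperp⟩
  have h1 := ((ℝ ∙ n).measurePreserving_measurableEquivProd a).symm
  have h1' : MeasurePreserving (((ℝ ∙ n).measurableEquivProd a).symm)
      (volume.prod volume) (volume : Measure (Pt d)) := by
    rw [← InnerProductSpace.euclideanHausdorffMeasure_eq_volume (V := Pt d)]
    exact h1
  have h2 : MeasurePreserving (LinearIsometryEquiv.toSpanUnitSingleton (𝕜 := ℝ) n hn)
      volume volume := LinearIsometryEquiv.measurePreserving _
  -- With `e = c • n + e'`, the point `a + w + t • e` has normal component `c * t` and tangential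
  -- component `w + t • e'`. The map is thus a scaling of `t` by `c`, which produces the factor
  -- `|c|`, followed by this volume-preserving shear.
  have h3 : MeasurePreserving (fun z : ℝ × (ℝ ∙ n)ᗮ => (z.1, z.2 + (c⁻¹ * z.1) • e'))
      (volume.prod volume) (volume.prod volume) := by
    refine (MeasurePreserving.id volume).skew_product (g := fun t w => w + (c⁻¹ * t) • e') ?_ ?_
    · fun_prop
    · exact Filter.Eventually.of_forall fun t => map_add_right_eq_self _ _
  have h4 : MeasurePreserving (fun t : ℝ => c * t)
      (ENNReal.ofReal |c| • volume) volume := by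
    refine ⟨by fun_prop, ?_⟩
    rw [Measure.map_smul]
    exact Real.smul_map_volume_mul_left he
  have h5 : MeasurePreserving (Prod.swap : (ℝ ∙ n)ᗮ × ℝ → ℝ × (ℝ ∙ n)ᗮ)
      (volume.prod (ENNReal.ofReal |c| • volume)) ((ENNReal.ofReal |c| • volume).prod volume) :=
    Measure.measurePreserving_swap
  have h6 := h1'.comp ((h2.prod (MeasurePreserving.id volume)).comp
    (h3.comp ((h4.prod (MeasurePreserving.id volume)).comp h5)))
  rw [← h6.map_eq, surf_restrict_hyperplane hn, Measure.prod_smul_right, Measure.map_smul]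
  congr 1
  have hm : (volume : Measure ℝ) = volume.map id := Measure.map_id.symm
  conv_rhs => rw [hm]
  rw [Measure.map_prod_map _ _ (isometry_planeParam n a).continuous.measurable measurable_id,
    Measure.map_map (by fun_prop)
      (((isometry_planeParam n a).continuous.measurable).prodMap measurable_id)]
  congr 1
  ext1 ⟨w, t⟩
  simp only [Function.comp_apply, Prod.swap_prod_mk, Prod.map_apply, id,
    Submodule.measurableEquivProd_symm_apply, LinearIsometryEquiv.toSpanUnitSingleton_apply,
    planeParam, Submodule.coe_add, Submodule.coe_smul, vadd_eq_add, e',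
    inv_mul_cancel_left₀ he]
  rw [smul_sub, smul_smul, mul_comm t c]
  abel

theorem integral_sweep (hn : ‖n‖ = 1) (a e : Pt d) (he : ⟪n, e⟫ ≠ 0) {f : Pt d → ℝ}
    (hf : Integrable f) :
    ∫ x, f x = |⟪n, e⟫| * ∫ y in hyperplane n a, (∫ t : ℝ, f (y + t • e)) ∂(surf d) := by
  have := sFinite_surf_restrict_hyperplane hn a
  have hm : Measurable (fun z : Pt d × ℝ => z.1 + z.2 • e) := by fun_prop
  have hv := volume_eq_map_sweep hn a e he
  have hc : ENNReal.ofReal |⟪n, e⟫| ≠ 0 := by simpa using he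
  rw [hv, integrable_smul_measure hc ENNReal.ofReal_ne_top] at hf
  rw [hv, integral_smul_measure, integral_map hm.aemeasurable hf.1, integral_prod,
    ENNReal.toReal_ofReal (abs_nonneg _), smul_eq_mul]
  exact (integrable_map_measure hf.1 hm.aemeasurable).1 hf

end Hyperplane

/-! ### Coordinates of derivatives, gradient and divergence -/

section Calculus

variable {d : ℕ}

theorem contDiff_coord {v : Pt d → Pt d} {n : WithTop ℕ∞} (hv : ContDiff ℝ n v) (k : Fin d) :
    ContDiff ℝ n fun x => v x k :=
  (EuclideanSpace.proj (𝕜 := ℝ) k).contDiff.comp hv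

theorem fderiv_coord {v : Pt d → Pt d} {x : Pt d} (hv : DifferentiableAt ℝ v x) (k : Fin d)
    (w : Pt d) : fderiv ℝ (fun y => v y k) x w = fderiv ℝ v x w k := by
  have h := (EuclideanSpace.proj (𝕜 := ℝ) k).hasFDerivAt.comp x hv.hasFDerivAt
  exact congrArg (fun L : Pt d →L[ℝ] ℝ => L w) h.fderiv

theorem continuous_divergence {v : Pt d → Pt d} (hv : ContDiff ℝ 1 v) :
    Continuous (divergence v) := by
  refine continuous_finsetSum _ fun k _ => ?_
  have h := (hv.continuous_fderiv one_ne_zero).clm_apply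
    (continuous_const (y := EuclideanSpace.single k (1 : ℝ)))
  exact (EuclideanSpace.proj (𝕜 := ℝ) k).continuous.comp h

theorem continuous_gradient {φ : Pt d → ℝ} (hφ : ContDiff ℝ 1 φ) : Continuous (gradient φ) :=
  (InnerProductSpace.toDual ℝ (Pt d)).symm.continuous.comp (hφ.continuous_fderiv one_ne_zero)

theorem inner_gradient_eq_sum (φ : Pt d → ℝ) (x v : Pt d) :
    ⟪v, gradient φ x⟫ = ∑ k, v k * fderiv ℝ φ x (EuclideanSpace.single k 1) := by
  rw [real_inner_comm, gradient, InnerProductSpace.toDual_symm_apply]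
  conv_lhs => rw [← (EuclideanSpace.basisFun (Fin d) ℝ).sum_repr v]
  simp

end Calculus

/-! ### The divergence theorem on a simplex -/

section DivergenceTheorem

variable {d : ℕ} [NeZero d] (s : Affine.Simplex ℝ (Pt d) d)

/-- The edge vector from vertex `l` to vertex `k`. -/
def edge (k l : Fin (d + 1)) : Pt d := s.points k - s.points l

variable {k l : Fin (d + 1)}

theorem bary_linear_edge_head (h : k ≠ l) : (bary s k).linear (edge s k l) = 1 := by
  rw [edge, bary_linear_sub, bary_point_self, bary_point_ne s h, sub_zero]

theorem bary_linear_edge_tail (h : k ≠ l) : (bary s l).linear (edge s k l) = -1 := by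
  rw [edge, bary_linear_sub, bary_point_self, bary_point_ne s h.symm, zero_sub]

theorem bary_linear_edge_other {j : Fin (d + 1)} (hk : j ≠ k) (hl : j ≠ l) :
    (bary s j).linear (edge s k l) = 0 := by
  rw [edge, bary_linear_sub, bary_point_ne s hk, bary_point_ne s hl, sub_zero]

/-- The projection along the edge `k l` onto the hyperplane of the facet opposite to `k`. -/
noncomputable def edgeProj (k l : Fin (d + 1)) (x : Pt d) : Pt d := x - bary s k x • edge s k l

theorem continuous_edgeProj : Continuous (edgeProj s k l) :=
  continuous_id.sub ((continuous_bary s k).smul continuous_const)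

theorem bary_add_smul (j : Fin (d + 1)) (x v : Pt d) (t : ℝ) :
    bary s j (x + t • v) = bary s j x + t * (bary s j).linear v := by
  rw [bary_add, map_smul, smul_eq_mul]

theorem edgeProj_add_smul (h : k ≠ l) (x : Pt d) (t : ℝ) :
    edgeProj s k l (x + t • edge s k l) = edgeProj s k l x := by
  rw [edgeProj, edgeProj, bary_add_smul, bary_linear_edge_head s h, mul_one, add_smul]
  abel

theorem bary_edgeProj (j : Fin (d + 1)) (x : Pt d) :
    bary s j (edgeProj s k l x) = bary s j x - bary s k x * (bary s j).linear (edge s k l) := by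
  have := bary_add_smul s j x (edge s k l) (-bary s k x)
  rw [neg_smul, ← sub_eq_add_neg] at this
  rw [edgeProj, this]
  ring

theorem edgeProj_of_mem {x : Pt d} (hx : bary s k x = 0) : edgeProj s k l x = x := by
  rw [edgeProj, hx, zero_smul, sub_zero]

/-- On the plane of facet `l`, projecting along the edge exchanges the coordinates `k` and `l` and
leaves the others alone. -/
theorem edgeProj_mem_facet_iff (h : k ≠ l) {x : Pt d} (hx : bary s l x = 0) :
    edgeProj s k l x ∈ facet s k ↔ x ∈ facet s l := by
  rw [mem_facet_iff, mem_facet_iff]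
  have hk : bary s k (edgeProj s k l x) = 0 := by
    rw [bary_edgeProj, bary_linear_edge_head s h]; ring
  have hl : bary s l (edgeProj s k l x) = bary s k x := by
    rw [bary_edgeProj, bary_linear_edge_tail s h, hx]; ring
  have ho : ∀ j, j ≠ k → j ≠ l → bary s j (edgeProj s k l x) = bary s j x := by
    intro j hjk hjl
    rw [bary_edgeProj, bary_linear_edge_other s hjk hjl]; ring
  constructor
  · rintro ⟨-, h2⟩
    refine ⟨hx, fun j => ?_⟩
    by_cases hjl : j = l
    · rw [hjl, hx]
    by_cases hjk : j = k
    · rw [hjk, ← hl]; exact h2 l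
    · rw [← ho j hjk hjl]; exact h2 j
  · rintro ⟨-, h2⟩
    refine ⟨hk, fun j => ?_⟩
    by_cases hjk : j = k
    · rw [hjk, hk]
    by_cases hjl : j = l
    · rw [hjl, hl]; exact h2 k
    · rw [ho j hjk hjl]; exact h2 j

theorem inner_normal_edge_head (h : k ≠ l) : ⟪normal s k, edge s k l⟫ = -alt s k := by
  rw [inner_normal_eq, bary_linear_edge_head s h, mul_one]

theorem inner_normal_edge_tail (h : k ≠ l) : ⟪normal s l, edge s k l⟫ = alt s l := by
  rw [inner_normal_eq, bary_linear_edge_tail s h]; ring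

theorem inner_normal_edge_other {j : Fin (d + 1)} (hk : j ≠ k) (hl : j ≠ l) :
    ⟪normal s j, edge s k l⟫ = 0 := by
  rw [inner_normal_eq, bary_linear_edge_other s hk hl, mul_zero]

theorem setIntegral_facetPlane_indicator (j : Fin (d + 1)) (g : Pt d → ℝ) :
    ∫ y in facetPlane s j, (facet s j).indicator g y ∂(surf d) = ∫ y in facet s j, g y ∂(surf d) := by
  rw [setIntegral_indicator (isCompact_facet s j).measurableSet,
    Set.inter_eq_right.2 (facet_subset_facetPlane s j)]

theorem integral_ite_add_mem_Icc (c v : ℝ) :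
    ∫ t : ℝ, (Set.Icc (0 : ℝ) 1).indicator (fun _ => v) (c + t) = v := by
  rw [integral_add_left_eq_self (fun t => (Set.Icc (0 : ℝ) 1).indicator (fun _ => v) t) c,
    integral_indicator measurableSet_Icc]
  simp

/-- The surface integrals over the facets opposite to the end points of an edge are related by
projection along the edge. -/
theorem integral_facet_edgeProj (h : k ≠ l) {g : Pt d → ℝ} (hg : Continuous g) :
    alt s l * ∫ y in facet s l, g (edgeProj s k l y) ∂(surf d) =
      alt s k * ∫ y in facet s k, g y ∂(surf d) := by
  classical
  set w := edge s k l with hw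
  -- `A` is the cylinder obtained by translating facet `k` along the edge. Both sides of the claim
  -- are the integral of `g ∘ edgeProj` over `A`, swept once from the plane of facet `l` and once
  -- from that of facet `k`.
  set A : Set (Pt d) := {x | bary s k x ∈ Set.Icc (0 : ℝ) 1 ∧ edgeProj s k l x ∈ facet s k} with hA
  have hAclosed : IsClosed A :=
    (isClosed_Icc.preimage (continuous_bary s k)).inter
      ((isCompact_facet s k).isClosed.preimage (continuous_edgeProj s))
  have hAcompact : IsCompact A := by
    have hc : IsCompact ((fun z : Pt d × ℝ => z.1 + z.2 • w) '' (facet s k ×ˢ Set.Icc 0 1)) :=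
      ((isCompact_facet s k).prod isCompact_Icc).image (by fun_prop)
    refine hc.of_isClosed_subset hAclosed ?_
    rintro x ⟨h1, h2⟩
    exact ⟨(edgeProj s k l x, bary s k x), ⟨h2, h1⟩, by simp [edgeProj, hw]⟩
  set G : Pt d → ℝ := A.indicator (fun x => g (edgeProj s k l x)) with hG
  have hGint : Integrable G := by
    rw [hG, integrable_indicator_iff hAclosed.measurableSet]
    exact (hg.comp (continuous_edgeProj s)).continuousOn.integrableOn_compact hAcompact
  -- The integrand is constant along the edge direction, and a line meeting `A` does so in a
  -- parameter interval of length 1, since `bary s k` grows at unit rate.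
  have hinner : ∀ y, ∫ t : ℝ, G (y + t • w) =
      (edgeProj s k l ⁻¹' facet s k).indicator (fun x => g (edgeProj s k l x)) y := by
    intro y
    rw [← integral_ite_add_mem_Icc (bary s k y)
      ((edgeProj s k l ⁻¹' facet s k).indicator (fun x => g (edgeProj s k l x)) y)]
    refine integral_congr_ae (Filter.Eventually.of_forall fun t => ?_)
    have hb : bary s k (y + t • w) = bary s k y + t := by
      rw [bary_add_smul, bary_linear_edge_head s h, mul_one]
    have hp : edgeProj s k l (y + t • w) = edgeProj s k l y := edgeProj_add_smul s h y t
    simp only [hG, hA, Set.indicator_apply, Set.mem_ofPred_eq, Set.mem_preimage, hb, hp]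
    split_ifs <;> simp_all
  have e1 := integral_sweep (norm_normal s k) (s.altitudeFoot k) w
    (by rw [inner_normal_edge_head s h]; exact neg_ne_zero.2 (alt_pos s k).ne') hGint
  have e2 := integral_sweep (norm_normal s l) (s.altitudeFoot l) w
    (by rw [inner_normal_edge_tail s h]; exact (alt_pos s l).ne') hGint
  rw [inner_normal_edge_head s h, abs_neg, abs_of_pos (alt_pos s k)] at e1
  rw [inner_normal_edge_tail s h, abs_of_pos (alt_pos s l)] at e2
  simp only [hinner] at e1 e2
  rw [← setIntegral_facetPlane_indicator, ← setIntegral_facetPlane_indicator]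
  refine Eq.trans ?_ (e2.symm.trans (e1.trans ?_))
  · congr 1
    refine setIntegral_congr_fun (measurableSet_hyperplane _ _) fun y hy => ?_
    have := edgeProj_mem_facet_iff s h ((mem_facetPlane_iff s).1 hy)
    simp only [Set.indicator_apply, Set.mem_preimage, this]
  · congr 1
    refine setIntegral_congr_fun (measurableSet_hyperplane _ _) fun y hy => ?_
    have := edgeProj_of_mem s (l := l) ((mem_facetPlane_iff s).1 hy)
    simp only [Set.indicator_apply, Set.mem_preimage, this]

/-- Along the edge only the coordinates `k` and `l` change. Starting on the plane of facet `l`, `t ≤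
0` keeps the latter nonnegative and `t ≥ -bary s k y` the former. -/
theorem add_smul_edge_mem_iff (h : k ≠ l) {y : Pt d} (hy : bary s l y = 0) (t : ℝ) :
    y + t • edge s k l ∈ s.closedInterior ↔ y ∈ facet s l ∧ t ∈ Set.Icc (-bary s k y) 0 := by
  rw [mem_closedInterior_iff, mem_facet_iff]
  have hk : bary s k (y + t • edge s k l) = bary s k y + t := by
    rw [bary_add_smul, bary_linear_edge_head s h, mul_one]
  have hl : bary s l (y + t • edge s k l) = -t := by
    rw [bary_add_smul, bary_linear_edge_tail s h, hy]; ring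
  have ho : ∀ j, j ≠ k → j ≠ l → bary s j (y + t • edge s k l) = bary s j y := by
    intro j hjk hjl
    rw [bary_add_smul, bary_linear_edge_other s hjk hjl]; ring
  constructor
  · intro H
    have h1 := H k
    have h2 := H l
    rw [hk] at h1
    rw [hl] at h2
    refine ⟨⟨hy, fun j => ?_⟩, by linarith, by linarith⟩
    by_cases hjl : j = l
    · rw [hjl, hy]
    by_cases hjk : j = k
    · rw [hjk]; linarith
    · rw [← ho j hjk hjl]; exact H j
  · rintro ⟨⟨-, H⟩, h1, h2⟩ j
    by_cases hjl : j = l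
    · rw [hjl, hl]; linarith
    by_cases hjk : j = k
    · rw [hjk, hk]; linarith
    · rw [ho j hjk hjl]; exact H j

theorem isFiniteMeasure_surf_restrict_facet (j : Fin (d + 1)) :
    IsFiniteMeasure ((surf d).restrict (facet s j)) := by
  refine ⟨?_⟩
  rw [Measure.restrict_apply_univ]
  exact surf_lt_top_of_isCompact (norm_normal s j) (isCompact_facet s j)
    (facet_subset_facetPlane s j)

theorem integrableOn_facet {g : Pt d → ℝ} (j : Fin (d + 1)) (hg : ContinuousOn g (facet s j)) :
    IntegrableOn g (facet s j) (surf d) := by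
  have := isFiniteMeasure_surf_restrict_facet s j
  obtain ⟨C, hC⟩ := (isCompact_facet s j).exists_bound_of_continuousOn hg
  exact Integrable.of_bound (hg.aestronglyMeasurable (isCompact_facet s j).measurableSet) C
    ((ae_restrict_iff' (isCompact_facet s j).measurableSet).2 (Filter.Eventually.of_forall hC))

/-- The divergence theorem on a simplex for a field parallel to an edge. -/
theorem integral_fderiv_edge (h : k ≠ l) {g : Pt d → ℝ} (hg : ContDiff ℝ 1 g) :
    ∫ x in s.closedInterior, fderiv ℝ g x (edge s k l) =
      alt s l * ∫ y in facet s l, g y ∂(surf d) - alt s k * ∫ y in facet s k, g y ∂(surf d) := by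
  classical
  set w := edge s k l with hw
  have hcont : Continuous fun x => fderiv ℝ g x w :=
    (hg.continuous_fderiv one_ne_zero).clm_apply continuous_const
  have hK : IsCompact s.closedInterior := s.isCompact_closedInterior
  have hint : Integrable (s.closedInterior.indicator fun x => fderiv ℝ g x w) := by
    rw [integrable_indicator_iff hK.measurableSet]
    exact hcont.continuousOn.integrableOn_compact hK
  -- Pulled back to facet `l`, the right side integrates `g y - g (edgeProj s k l y)`. This is the
  -- fundamental theorem of calculus on the segment that the line through `y` cuts out of the
  -- simplex, with end points on facets `k` and `l`.
  rw [← integral_facet_edgeProj s h hg.continuous, ← mul_sub, ← integral_sub,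
    ← integral_indicator hK.measurableSet,
    integral_sweep (norm_normal s l) (s.altitudeFoot l) w
      (by rw [inner_normal_edge_tail s h]; exact (alt_pos s l).ne') hint,
    inner_normal_edge_tail s h, abs_of_pos (alt_pos s l), ← setIntegral_facetPlane_indicator]
  · congr 1
    refine setIntegral_congr_fun (measurableSet_hyperplane _ _) fun y hy => ?_
    have hy0 := (mem_facetPlane_iff s).1 hy
    have hmem := add_smul_edge_mem_iff s h hy0
    simp only [Set.indicator_apply, hmem, hw]
    by_cases hyF : y ∈ facet s l
    · have hnn : -bary s k y ≤ 0 := neg_nonpos.2 (((mem_facet_iff s).1 hyF).2 k)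
      simp only [hyF, true_and, if_true]
      have hderiv : ∀ t : ℝ, HasDerivAt (fun t : ℝ => g (y + t • w)) (fderiv ℝ g (y + t • w) w) t := by
        intro t
        have h1 : HasDerivAt (fun t : ℝ => y + t • w) w t := by
          simpa using ((hasDerivAt_id t).smul_const w).const_add y
        exact ((hg.differentiable one_ne_zero) (y + t • w)).hasFDerivAt.comp_hasDerivAt t h1
      have hc2 : Continuous fun t : ℝ => fderiv ℝ g (y + t • w) w := hcont.comp (by fun_prop)
      have hftc := intervalIntegral.integral_eq_sub_of_hasDerivAt
        (a := -bary s k y) (b := 0) (fun t _ => hderiv t) (hc2.intervalIntegrable _ _)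
      have hI : ∫ t : ℝ, (if t ∈ Set.Icc (-bary s k y) 0 then fderiv ℝ g (y + t • w) w else 0) =
          ∫ t in Set.Icc (-bary s k y) 0, fderiv ℝ g (y + t • w) w := by
        rw [← integral_indicator measurableSet_Icc]
        simp only [Set.indicator_apply]
      refine hI.trans ?_
      rw [integral_Icc_eq_integral_Ioc, ← intervalIntegral.integral_of_le hnn, hftc]
      simp [edgeProj, sub_eq_add_neg, hw]
    · simp [hyF]
  · exact integrableOn_facet s l hg.continuous.continuousOn
  · exact integrableOn_facet s l
      (hg.continuous.comp (continuous_edgeProj s)).continuousOn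

/-- The divergence theorem on a simplex for a field of constant direction. -/
theorem integral_fderiv_simplex {g : Pt d → ℝ} (hg : ContDiff ℝ 1 g) (w : Pt d) :
    ∫ x in s.closedInterior, fderiv ℝ g x w =
      ∑ j, ⟪normal s j, w⟫ * ∫ y in facet s j, g y ∂(surf d) := by
  have hK : IsCompact s.closedInterior := s.isCompact_closedInterior
  have hint : IntegrableOn (fderiv ℝ g) s.closedInterior :=
    (hg.continuous_fderiv one_ne_zero).continuousOn.integrableOn_compact hK
  let A : Pt d →ₗ[ℝ] ℝ := (∫ x in s.closedInterior, fderiv ℝ g x : Pt d →L[ℝ] ℝ).toLinearMap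
  let B : Pt d →ₗ[ℝ] ℝ :=
    ∑ j, (∫ y in facet s j, g y ∂(surf d)) • (innerSL ℝ (normal s j)).toLinearMap
  have hA : ∀ v, A v = ∫ x in s.closedInterior, fderiv ℝ g x v := fun v =>
    ContinuousLinearMap.integral_apply hint v
  have hB : ∀ v, B v = ∑ j, ⟪normal s j, v⟫ * ∫ y in facet s j, g y ∂(surf d) := by
    intro v
    simp only [B, LinearMap.sum_apply, LinearMap.smul_apply, ContinuousLinearMap.coe_coe,
      innerSL_apply_apply, smul_eq_mul]
    exact Finset.sum_congr rfl fun j _ => mul_comm _ _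
  -- Both sides are linear in the direction, and the edges issuing from vertex 0 form a basis. For
  -- such an edge only the facets opposite to its two ends have a normal not orthogonal to it.
  have hAB : A = B := by
    refine ((vertexBasis s).basisOf 0).ext fun ⟨k, hk⟩ => ?_
    rw [AffineBasis.basisOf_apply]
    change A (edge s k 0) = B (edge s k 0)
    rw [hA, hB, integral_fderiv_edge s hk hg,
      ← Finset.sum_subset (Finset.subset_univ {0, k}), Finset.sum_pair hk.symm,
      inner_normal_edge_tail s hk, inner_normal_edge_head s hk]
    · ring
    · intro j _ hj
      simp only [Finset.mem_insert, Finset.mem_singleton, not_or] at hj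
      rw [inner_normal_edge_other s hj.2 hj.1, zero_mul]
  rw [← hA, ← hB, hAB]

/-- Integration by parts on a simplex. -/
theorem integral_inner_gradient_add_divergence {v : Pt d → Pt d} (hv : ContDiff ℝ 1 v)
    {φ : Pt d → ℝ} (hφ : ContDiff ℝ 1 φ) :
    (∫ x in s.closedInterior, ⟪v x, gradient φ x⟫) + ∫ x in s.closedInterior, divergence v x * φ x =
      ∑ j, ∫ x in facet s j, ⟪v x, normal s j⟫ * φ x ∂(surf d) := by
  have hK : IsCompact s.closedInterior := s.isCompact_closedInterior
  have hprod : ∀ k, ContDiff ℝ 1 fun x => v x k * φ x := fun k => (contDiff_coord hv k).mul hφ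
  rw [← integral_add]
  · calc ∫ x in s.closedInterior, ⟪v x, gradient φ x⟫ + divergence v x * φ x
        = ∫ x in s.closedInterior,
            ∑ k, fderiv ℝ (fun x => v x k * φ x) x (EuclideanSpace.single k 1) := by
          congr 1
          ext x
          rw [inner_gradient_eq_sum, divergence, Finset.sum_mul, ← Finset.sum_add_distrib]
          refine Finset.sum_congr rfl fun k _ => ?_
          have h1 := (contDiff_coord hv k).differentiable one_ne_zero x
          have h2 := hφ.differentiable one_ne_zero x
          rw [fderiv_fun_mul h1 h2]
          simp only [add_apply, smul_apply, smul_eq_mul,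
            fderiv_coord (hv.differentiable one_ne_zero x)]
          ring
      _ = ∑ k, ∫ x in s.closedInterior,
            fderiv ℝ (fun x => v x k * φ x) x (EuclideanSpace.single k 1) := by
          refine integral_finsetSum _ fun k _ => ?_
          exact (((hprod k).continuous_fderiv one_ne_zero).clm_apply
            continuous_const).continuousOn.integrableOn_compact hK
      _ = ∑ k, ∑ j, ⟪normal s j, EuclideanSpace.single k 1⟫ *
            ∫ y in facet s j, v y k * φ y ∂(surf d) :=
          Finset.sum_congr rfl fun k _ => integral_fderiv_simplex s (hprod k) _
      _ = ∑ j, ∫ x in facet s j, ⟪v x, normal s j⟫ * φ x ∂(surf d) := by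
          rw [Finset.sum_comm]
          refine Finset.sum_congr rfl fun j _ => ?_
          simp only [← integral_const_mul]
          rw [← integral_finsetSum]
          · congr 1
            ext x
            rw [PiLp.inner_apply, Finset.sum_mul]
            refine Finset.sum_congr rfl fun k _ => ?_
            simp [EuclideanSpace.inner_single_right]
            ring
          · intro k _
            exact (integrableOn_facet s j
              (hprod k).continuous.continuousOn).const_mul _
  · exact (hv.continuous.inner (continuous_gradient hφ)).continuousOn.integrableOn_compact hK
  · exact ((continuous_divergence hv).mul hφ.continuous).continuousOn.integrableOn_compact hK

end DivergenceTheorem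

/-! ### Degrees of derivatives; Raviart–Thomas fields -/

section Polynomials

variable {d : ℕ}

theorem totalDegree_pderiv_le (k : Fin d) (P : MvPolynomial (Fin d) ℝ) :
    (MvPolynomial.pderiv k P).totalDegree ≤ P.totalDegree - 1 := by
  conv_lhs => rw [P.as_sum, map_sum]
  refine MvPolynomial.totalDegree_finsetSum_le fun m hm => ?_
  rw [MvPolynomial.pderiv_monomial]
  by_cases hmk : m k = 0
  · simp [hmk]
  · refine (MvPolynomial.totalDegree_monomial_le _ _).trans ?_
    have h1 : m.degree ≤ P.totalDegree := MvPolynomial.le_totalDegree hm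
    have h2 : m - Finsupp.single k 1 + Finsupp.single k 1 = m :=
      tsub_add_cancel_of_le (Finsupp.single_le_iff.2 (Nat.one_le_iff_ne_zero.2 hmk))
    have h3 := congrArg Finsupp.degree h2
    rw [map_add, Finsupp.degree_single] at h3
    change (m - Finsupp.single k 1).degree ≤ _
    omega

theorem contDiff_eval (P : MvPolynomial (Fin d) ℝ) {n : WithTop ℕ∞} :
    ContDiff ℝ n fun x : Pt d => MvPolynomial.eval (fun k => x k) P := by
  induction P using MvPolynomial.induction_on with
  | C a => simpa using contDiff_const
  | add P Q hP hQ => simpa using hP.add hQ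
  | mul_X P k hP =>
    simpa using hP.mul (contDiff_coord (d := d) contDiff_id k)

theorem fderiv_eval (P : MvPolynomial (Fin d) ℝ) (k : Fin d) (x : Pt d) :
    fderiv ℝ (fun x : Pt d => MvPolynomial.eval (fun k => x k) P) x (EuclideanSpace.single k 1) =
      MvPolynomial.eval (fun k => x k) (MvPolynomial.pderiv k P) := by
  induction P using MvPolynomial.induction_on with
  | C a => simp
  | add P Q hP hQ =>
    simp only [map_add]
    rw [fderiv_fun_add ((contDiff_eval P (n := 1)).differentiable one_ne_zero x)
      ((contDiff_eval Q (n := 1)).differentiable one_ne_zero x), add_apply, hP, hQ]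
  | mul_X P j hP =>
    simp only [map_mul, MvPolynomial.eval_X]
    have hX : DifferentiableAt ℝ (fun x : Pt d => x j) x :=
      (contDiff_coord (d := d) (n := 1) contDiff_id j).differentiable one_ne_zero x
    have hXd : fderiv ℝ (fun x : Pt d => x j) x (EuclideanSpace.single k 1) =
        (Pi.single k (1 : ℝ) : Fin d → ℝ) j := by
      rw [fderiv_coord (v := fun y : Pt d => y) (x := x) differentiableAt_id j
        (EuclideanSpace.single k 1), fderiv_fun_id]
      rfl
    rw [fderiv_fun_mul ((contDiff_eval P (n := 1)).differentiable one_ne_zero x) hX, add_apply,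
      smul_apply, smul_apply, hP, hXd, MvPolynomial.pderiv_mul, MvPolynomial.pderiv_X]
    by_cases hjk : k = j
    · subst hjk; simp [mul_comm, add_comm]
    · simp [Pi.single_eq_of_ne' hjk, mul_comm]

variable {p : ℕ}

theorem IsPoly.contDiff {f : Pt d → ℝ} (hf : IsPoly p f) {n : WithTop ℕ∞} : ContDiff ℝ n f := by
  obtain ⟨P, -, hP⟩ := hf
  rw [funext hP]
  exact contDiff_eval P

theorem IsPoly.continuous {f : Pt d → ℝ} (hf : IsPoly p f) : Continuous f :=
  (hf.contDiff (n := 0)).continuous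

theorem IsPolyVec.contDiff {v : Pt d → Pt d} (hv : IsPolyVec p v) {n : WithTop ℕ∞} :
    ContDiff ℝ n v :=
  contDiff_euclidean.2 fun k => (hv k).contDiff

theorem IsPoly.mono {q : ℕ} {f : Pt d → ℝ} (hf : IsPoly p f) (h : p ≤ q) : IsPoly q f := by
  obtain ⟨P, hP, hP'⟩ := hf
  exact ⟨P, hP.trans h, hP'⟩

theorem IsPoly.zero : IsPoly p (0 : Pt d → ℝ) := ⟨0, by simp, by simp⟩

theorem IsPoly.add {f g : Pt d → ℝ} (hf : IsPoly p f) (hg : IsPoly p g) :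
    IsPoly p fun x => f x + g x := by
  obtain ⟨P, hP, hP'⟩ := hf
  obtain ⟨Q, hQ, hQ'⟩ := hg
  exact ⟨P + Q, (MvPolynomial.totalDegree_add _ _).trans (max_le hP hQ), by simp [hP', hQ']⟩

theorem IsPoly.mul_const {f : Pt d → ℝ} (hf : IsPoly p f) (c : ℝ) : IsPoly p fun x => f x * c := by
  obtain ⟨P, hP, hP'⟩ := hf
  refine ⟨P * MvPolynomial.C c, ?_, by simp [hP']⟩
  refine (MvPolynomial.totalDegree_mul _ _).trans ?_
  simpa using hP

theorem IsPoly.sub {f g : Pt d → ℝ} (hf : IsPoly p f) (hg : IsPoly p g) :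
    IsPoly p fun x => f x - g x := by
  simpa [sub_eq_add_neg] using hf.add (hg.mul_const (-1))

theorem IsPoly.mul_coord {f : Pt d → ℝ} (hf : IsPoly p f) (k : Fin d) :
    IsPoly (p + 1) fun x => f x * x k := by
  obtain ⟨P, hP, hP'⟩ := hf
  refine ⟨P * MvPolynomial.X k, ?_, by simp [hP']⟩
  refine (MvPolynomial.totalDegree_mul _ _).trans ?_
  simpa using hP

theorem IsPoly.sum {α : Type*} (t : Finset α) {f : α → Pt d → ℝ} (hf : ∀ a ∈ t, IsPoly p (f a)) :
    IsPoly p fun x => ∑ a ∈ t, f a x := by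
  classical
  induction t using Finset.induction_on with
  | empty => simpa using! (IsPoly.zero : IsPoly p (0 : Pt d → ℝ))
  | insert a t ha ih =>
    simp only [Finset.sum_insert ha]
    exact (hf a (Finset.mem_insert_self _ _)).add
      (ih fun b hb => hf b (Finset.mem_insert_of_mem hb))

theorem IsPoly.fderiv_single {f : Pt d → ℝ} (hf : IsPoly p f) (k : Fin d) :
    IsPoly (p - 1) fun x => fderiv ℝ f x (EuclideanSpace.single k 1) := by
  obtain ⟨P, hP, hP'⟩ := hf
  refine ⟨MvPolynomial.pderiv k P,
    (totalDegree_pderiv_le k P).trans (Nat.sub_le_sub_right hP 1), fun x => ?_⟩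
  rw [funext hP']
  exact fderiv_eval P k x

theorem IsPolyVec.divergence {v : Pt d → Pt d} (hv : IsPolyVec p v) :
    IsPoly (p - 1) (divergence v) := by
  have h : HDG.divergence v = fun x => ∑ k, fderiv ℝ (fun y => v y k) x (EuclideanSpace.single k 1) := by
    ext x
    exact Finset.sum_congr rfl fun k _ =>
      (fderiv_coord ((hv.contDiff (n := 1)).differentiable one_ne_zero x) k _).symm
  rw [h]
  exact IsPoly.sum _ fun k _ => (hv k).fderiv_single k

theorem gradient_apply (f : Pt d → ℝ) (x : Pt d) (k : Fin d) :
    gradient f x k = fderiv ℝ f x (EuclideanSpace.single k 1) := by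
  have h := inner_gradient_eq_sum f x (EuclideanSpace.single k 1)
  simp only [EuclideanSpace.inner_single_left, map_one, one_mul] at h
  rw [h, Finset.sum_eq_single k (fun j _ hj => by simp [hj]) (by simp)]
  simp

theorem IsPoly.gradient {f : Pt d → ℝ} (hf : IsPoly p f) :
    IsPolyVec (p - 1) (gradient f) := by
  intro k
  simp only [gradient_apply]
  exact hf.fderiv_single k

/-- Truncated subtraction makes `IsPoly.gradient` yield only degree 0 when `p = 0`. The lowest-order
case, which has no element moments, needs this stronger fact. -/
theorem IsPoly.gradient_eq_zero {f : Pt d → ℝ} (hf : IsPoly 0 f) (x : Pt d) :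
    _root_.gradient f x = 0 := by
  obtain ⟨P, hP, hP'⟩ := hf
  have hC := MvPolynomial.totalDegree_eq_zero_iff_eq_C.1 (Nat.le_zero.1 hP)
  have : f = fun _ => MvPolynomial.coeff 0 P := by
    ext x
    rw [hP' x, hC]
    simp
  rw [this, gradient_fun_const]

theorem IsPolyVec.inner_const {v : Pt d → Pt d} (hv : IsPolyVec p v) (n : Pt d) :
    IsPoly p fun x => ⟪v x, n⟫ := by
  have : (fun x => ⟪v x, n⟫) = fun x => ∑ k, v x k * n k := by
    ext x
    rw [PiLp.inner_apply]
    exact Finset.sum_congr rfl fun k _ => by simp [mul_comm]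
  rw [this]
  exact IsPoly.sum _ fun k _ => (hv k).mul_const _

theorem IsRaviartThomas.isPolyVec {v : Pt d → Pt d} (hv : IsRaviartThomas p v) :
    IsPolyVec (p + 1) v := by
  obtain ⟨a, s, ha, hs, h⟩ := hv
  intro k
  have : (fun x => v x k) = fun x => a x k + s x * x k := by
    ext x
    simp [h x]
  rw [this]
  exact ((ha k).mono (Nat.le_succ p)).add (hs.mul_coord k)

theorem IsRaviartThomas.contDiff {v : Pt d → Pt d} (hv : IsRaviartThomas p v)
    {n : WithTop ℕ∞} : ContDiff ℝ n v :=
  hv.isPolyVec.contDiff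

theorem IsRaviartThomas.isPoly_divergence {v : Pt d → Pt d} (hv : IsRaviartThomas p v) :
    IsPoly p (HDG.divergence v) :=
  hv.isPolyVec.divergence

/-- The normal component of a Raviart–Thomas field on a hyperplane is a polynomial of degree `p`. -/
theorem IsRaviartThomas.exists_isPoly_inner {v : Pt d → Pt d} (hv : IsRaviartThomas p v)
    (n b : Pt d) : ∃ π, IsPoly p π ∧ ∀ x ∈ hyperplane n b, ⟪v x, n⟫ = π x := by
  obtain ⟨a, s, ha, hs, h⟩ := hv
  refine ⟨_, (ha.inner_const n).add (hs.mul_const ⟪n, b⟫), fun x hx => ?_⟩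
  have hx' : ⟪n, x⟫ = ⟪n, b⟫ := by
    have : ⟪n, x - b⟫ = 0 := hx
    rw [inner_sub_right] at this
    linarith
  rw [h x, inner_add_left, inner_smul_left, real_inner_comm n x, hx', conj_trivial]

end Polynomials

/-! ### Facet moments determine polynomials on a facet -/

section FacetPolynomials

variable {d : ℕ} [NeZero d] (s : Affine.Simplex ℝ (Pt d) d) {j : Fin (d + 1)} {p : ℕ}

theorem eq_zero_of_integral_facet_mul_self {ψ : Pt d → ℝ} (hψ : Continuous ψ)
    (h : ∫ x in facet s j, ψ x * ψ x ∂(surf d) = 0) {x : Pt d} (hx : x ∈ facet s j) : ψ x = 0 := by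
  rw [integral_eq_zero_iff_of_nonneg (fun x => mul_self_nonneg _)
    (integrableOn_facet s j (hψ.mul hψ).continuousOn)] at h
  have hae : ∀ᵐ x ∂((surf d).restrict (facet s j)), ψ x = 0 := by
    filter_upwards [h] with x hx using mul_self_eq_zero.1 hx
  -- At a relatively interior point, a nonzero value would persist on a relatively open piece of the
  -- facet, which has positive surface measure.
  have hopen : ∀ y, bary s j y = 0 → (∀ k, k ≠ j → 0 < bary s k y) → ψ y = 0 := by
    intro y hy0 hy
    by_contra hne
    let U : Set (Pt d) := {z | ψ z ≠ 0} ∩ ⋂ k ∈ Finset.univ.erase j, {z | 0 < bary s k z}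
    have hU : IsOpen U := by
      refine (isOpen_ne_fun hψ continuous_const).inter (isOpen_biInter_finset fun k _ => ?_)
      exact isOpen_lt continuous_const (continuous_bary s k)
    have hyU : y ∈ U := by
      refine ⟨hne, Set.mem_iInter₂.2 fun k hk => hy k (Finset.ne_of_mem_erase hk)⟩
    have hpos := surf_inter_hyperplane_pos (norm_normal s j) hU hyU ((mem_facetPlane_iff s).2 hy0)
    have hsub : U ∩ facetPlane s j ⊆ {z | ¬ ψ z = 0} ∩ facet s j := by
      rintro z ⟨⟨hz1, hz2⟩, hz3⟩
      have hzj := (mem_facetPlane_iff s).1 hz3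
      refine ⟨hz1, (mem_facet_iff s).2 ⟨hzj, fun k => ?_⟩⟩
      by_cases hk : k = j
      · rw [hk, hzj]
      · exact (Set.mem_iInter₂.1 hz2 k (Finset.mem_erase.2 ⟨hk, Finset.mem_univ k⟩)).le
    have h0 : surf d ({z | ¬ ψ z = 0} ∩ facet s j) = 0 := by
      rw [ae_iff, Measure.restrict_apply
        (isOpen_ne_fun hψ continuous_const).measurableSet] at hae
      exact hae
    exact hpos.ne' (measure_mono_null hsub h0)
  have hx' := (mem_facet_iff s).1 hx
  -- Any point of the closed facet is reached along the segment from the barycentre, which is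
  -- relatively interior except possibly at its end; continuity gives the value there.
  have hzero : ∀ t ∈ Set.Ioc (0 : ℝ) 1, ψ (AffineMap.lineMap x (facetCenter s j) t) = 0 := by
    intro t ht
    refine hopen _ ?_ fun k hk => ?_
    · rw [bary_lineMap, hx'.1, bary_facetCenter, if_pos rfl]; ring
    · rw [bary_lineMap]
      have h1 := hx'.2 k
      have h2 := bary_facetCenter_pos s hk
      have h3 : 0 ≤ 1 - t := sub_nonneg.2 ht.2
      have h4 := mul_pos ht.1 h2
      positivity
  have hcont : Continuous fun t : ℝ => ψ (AffineMap.lineMap x (facetCenter s j) t) :=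
    hψ.comp AffineMap.lineMap_continuous
  have hclosed : IsClosed {t : ℝ | ψ (AffineMap.lineMap x (facetCenter s j) t) = 0} :=
    isClosed_eq hcont continuous_const
  have h0 : (0 : ℝ) ∈ closure (Set.Ioc (0 : ℝ) 1) := by
    rw [closure_Ioc zero_ne_one]; simp
  have := hclosed.closure_subset_iff.2 hzero h0
  simpa using this

/-- A polynomial orthogonal to all polynomials of its degree on a facet vanishes there. -/
theorem IsPoly.eq_zero_on_facet {π : Pt d → ℝ} (hπ : IsPoly p π)
    (h : ∀ w, IsPoly p w → ∫ x in facet s j, π x * w x ∂(surf d) = 0) :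
    ∀ x ∈ facet s j, π x = 0 := fun _ hx =>
  eq_zero_of_integral_facet_mul_self s hπ.continuous (h π hπ) hx

/-- The default value 0 is a polynomial too, so this holds without knowing that a projection exists.
-/
theorem l2Proj_isPoly (μ : Measure (Pt d)) (p : ℕ) (g : Pt d → ℝ) : IsPoly p (l2Proj μ p g) := by
  unfold l2Proj
  split_ifs with h
  · exact h.choose_spec.1
  · exact IsPoly.zero

end FacetPolynomials

/-! ### Neighbouring elements and their normals -/

section MeshTopology

open Filter Topology

variable {d : ℕ} [NeZero d] (s s' : Affine.Simplex ℝ (Pt d) d) {j j' : Fin (d + 1)}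

theorem affineMap_apply_eq_sum_bary (f : Pt d →ᵃ[ℝ] ℝ) (x : Pt d) :
    f x = ∑ k, bary s k x * f (s.points k) := by
  conv_lhs => rw [← affineCombination_bary s x]
  rw [Finset.map_affineCombination _ _ _ (sum_bary s x),
    Finset.affineCombination_eq_linear_combination _ _ _ (sum_bary s x)]
  rfl

theorem facet_eq_convexHull (j : Fin (d + 1)) :
    facet s j = convexHull ℝ (s.points '' {j}ᶜ) := by
  rw [← s.range_faceOpposite_points, Affine.Simplex.convexHull_eq_closedInterior]
  rfl

theorem point_mem_facet {k : Fin (d + 1)} (h : k ≠ j) : s.points k ∈ facet s j := by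
  rw [facet_eq_convexHull]
  exact subset_convexHull ℝ _ ⟨k, h, rfl⟩

variable {s s'}

/-- Two simplices with a common facet have proportional barycentric coordinates for the opposite
vertices. -/
theorem bary_eq_smul_of_facet_eq (h : facet s j = facet s' j') (x : Pt d) :
    bary s' j' x = bary s' j' (s.points j) * bary s j x := by
  -- All vertices of `s` except the `j`-th lie on the common facet, where `bary s' j'` vanishes.
  rw [affineMap_apply_eq_sum_bary s, Finset.sum_eq_single j, mul_comm]
  · intro k _ hk
    have hk' : s.points k ∈ facet s' j' := h ▸ point_mem_facet s hk
    rw [((mem_facet_iff s').1 hk').1, mul_zero]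
  · simp

theorem bary_pos_of_facet_eq (h : facet s j = facet s' j') {k : Fin (d + 1)} (hk : k ≠ j') :
    0 < bary s' k (facetCenter s j) := by
  have hnn : ∀ i, i ≠ j → 0 ≤ bary s' k (s.points i) := fun i hi =>
    ((mem_facet_iff s').1 (h ▸ point_mem_facet s hi)).2 k
  rw [affineMap_apply_eq_sum_bary s, ← Finset.sum_erase_add _ _ (Finset.mem_univ j),
    bary_facetCenter s j j, if_pos rfl, zero_mul, add_zero]
  refine Finset.sum_pos' (fun i hi => mul_nonneg
    (bary_facetCenter_pos s (Finset.ne_of_mem_erase hi)).le (hnn i (Finset.ne_of_mem_erase hi))) ?_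
  -- Otherwise coordinate `k` of `s'` vanishes at all vertices of the common facet, hence on the
  -- whole facet, although it is 1 at the vertex `k` of `s'`, which lies there.
  by_contra hcon
  push Not at hcon
  have hz : ∀ i, i ≠ j → bary s' k (s.points i) = 0 := by
    intro i hi
    refine le_antisymm ?_ (hnn i hi)
    have := hcon i (Finset.mem_erase.2 ⟨hi, Finset.mem_univ i⟩)
    exact nonpos_of_mul_nonpos_right this (bary_facetCenter_pos s hi)
  have hmem : s'.points k ∈ facet s j := h ▸ point_mem_facet s' hk
  have h1 := bary_point_self s' k
  rw [affineMap_apply_eq_sum_bary s, Finset.sum_eq_zero] at h1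
  · exact zero_ne_one h1
  · intro i _
    by_cases hi : i = j
    · rw [hi, ((mem_facet_iff s).1 hmem).1, zero_mul]
    · rw [hz i hi, mul_zero]

/-- Non-overlapping simplices with a common facet lie on opposite sides of it. -/
theorem normal_eq_neg_of_facet_eq (h : facet s j = facet s' j')
    (hdisj : Disjoint s.interior s'.interior) : normal s' j' = -normal s j := by
  set c := bary s' j' (s.points j) with hc
  have hb := bary_eq_smul_of_facet_eq h
  -- If `c > 0`, moving slightly from the facet's barycentre towards vertex `j` enters both open
  -- simplices.
  have hc0 : c ≤ 0 := by
    by_contra hpos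
    push Not at hpos
    have hev : ∀ᶠ t : ℝ in 𝓝[>] 0, ∀ k, k ≠ j' →
        0 < bary s' k (AffineMap.lineMap (facetCenter s j) (s.points j) t) := by
      refine eventually_all.2 fun k => ?_
      by_cases hk : k = j'
      · exact Eventually.of_forall fun t h => absurd hk h
      · have hcont : Continuous fun t : ℝ =>
            bary s' k (AffineMap.lineMap (facetCenter s j) (s.points j) t) :=
          (continuous_bary s' k).comp AffineMap.lineMap_continuous
        have h0 : 0 < bary s' k (AffineMap.lineMap (facetCenter s j) (s.points j) (0 : ℝ)) := by
          rw [AffineMap.lineMap_apply_zero]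
          exact bary_pos_of_facet_eq h hk
        filter_upwards [nhdsWithin_le_nhds (hcont.continuousAt.eventually_const_lt h0)] with t ht _
          using ht
    have hIoo : ∀ᶠ t : ℝ in 𝓝[>] 0, t ∈ Set.Ioo (0 : ℝ) 1 := Ioo_mem_nhdsGT zero_lt_one
    obtain ⟨t, ht1, ht2⟩ := (hev.and hIoo).exists
    set y := AffineMap.lineMap (facetCenter s j) (s.points j) t with hy
    have hyj : bary s j y = t := by
      rw [hy, bary_lineMap, bary_facetCenter, if_pos rfl, bary_point_self]; ring
    refine Set.disjoint_left.1 hdisj (show y ∈ s.interior from (mem_interior_iff s).2 fun k => ?_)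
      ((mem_interior_iff s').2 fun k => ?_)
    · by_cases hk : k = j
      · rw [hk, hyj]; exact ht2.1
      · rw [hy, bary_lineMap, bary_point_ne s hk, mul_zero, add_zero]
        exact mul_pos (sub_pos.2 ht2.2) (bary_facetCenter_pos s hk)
    · by_cases hk : k = j'
      · rw [hk, hb, hyj]; exact mul_pos hpos ht2.1
      · exact ht1 k hk
  have hlin : ∀ v, (bary s' j').linear v = c * (bary s j).linear v := by
    intro v
    have h1 := hb v
    have h0 := hb 0
    have e1 := bary_linear_sub s' j' v 0
    have e0 := bary_linear_sub s j v 0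
    rw [sub_zero] at e1 e0
    rw [e1, e0, h1, h0]
    ring
  set r := alt s' j' * c / alt s j with hr
  have hn : normal s' j' = r • normal s j := by
    refine ext_inner_right ℝ fun v => ?_
    rw [inner_smul_left, inner_normal_eq, inner_normal_eq, hlin, conj_trivial, hr]
    have := (alt_pos s j).ne'
    field_simp
  have hr0 : r ≤ 0 :=
    div_nonpos_of_nonpos_of_nonneg (mul_nonpos_of_nonneg_of_nonpos (alt_pos s' j').le hc0)
      (alt_pos s j).le
  have hr1 := congrArg norm hn
  rw [norm_smul, norm_normal, norm_normal, mul_one, Real.norm_eq_abs, abs_of_nonpos hr0] at hr1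
  rw [hn, show r = -1 by linarith, neg_one_smul]

variable {ι : Type*} {Ω : Set (Pt d)} {K : ι → Affine.Simplex ℝ (Pt d) d}

theorem IsInteriorFacet.symm {i i' : ι} (h : IsInteriorFacet K i j i' j') :
    IsInteriorFacet K i' j' i j := ⟨h.1.symm, h.2.symm⟩

theorem IsMesh.normal_eq_neg (hK : IsMesh Ω K) {i i' : ι} (h : IsInteriorFacet K i j i' j') :
    normal (K i') j' = -normal (K i) j :=
  normal_eq_neg_of_facet_eq h.2 (hK.nonoverlapping i i' h.1)

/-- An interior facet belongs to only one further element. -/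
theorem IsMesh.interiorFacet_unique (hK : IsMesh Ω K) {i i₁ i₂ : ι} {j₁ j₂ : Fin (d + 1)}
    (h₁ : IsInteriorFacet K i j i₁ j₁) (h₂ : IsInteriorFacet K i j i₂ j₂) : i₁ = i₂ ∧ j₁ = j₂ := by
  have hi : i₁ = i₂ := by
    by_contra hne
    -- Three distinct elements around one facet would have pairwise opposite unit normals, which is
    -- impossible.
    have h3 := hK.normal_eq_neg (⟨hne, h₁.2.symm.trans h₂.2⟩ : IsInteriorFacet K i₁ j₁ i₂ j₂)
    rw [hK.normal_eq_neg h₁, hK.normal_eq_neg h₂, neg_neg] at h3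
    have h4 : normal (K i) j = 0 := by
      have : (2 : ℝ) • normal (K i) j = 0 := by
        rw [two_smul]
        nth_rw 1 [← h3]
        exact neg_add_cancel _
      exact (smul_eq_zero.1 this).resolve_left two_ne_zero
    have h5 := norm_normal (K i) j
    rw [h4, norm_zero] at h5
    exact zero_ne_one h5
  subst hi
  exact ⟨rfl, facet_injective _ (h₁.2.symm.trans h₂.2)⟩

theorem range_points_eq_of_subset (h : Set.range s.points ⊆ Set.range s'.points) :
    Set.range s.points = Set.range s'.points := by
  refine Set.eq_of_subset_of_ncard_le h ?_ (Set.finite_range _)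
  rw [Set.ncard_range_of_injective s.independent.injective,
    Set.ncard_range_of_injective s'.independent.injective]

/-- A facet of a conforming mesh either lies on the boundary or is a facet of a second element. -/
theorem IsMesh.exists_isInteriorFacet [Finite ι] (hΩ : IsOpen Ω) (hK : IsMesh Ω K) {i : ι}
    (h : ¬ facet (K i) j ⊆ frontier Ω) : ∃ i' j', IsInteriorFacet K i j i' j' := by
  have hsub : ∀ i, (K i).closedInterior ⊆ closure Ω := fun i =>
    hK.cover ▸ Set.subset_iUnion (fun i => (K i).closedInterior) i
  obtain ⟨y, hy, hyf⟩ := Set.not_subset.1 h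
  have hyΩ : y ∈ Ω := by
    by_contra hn
    exact hyf ⟨hsub i (facet_subset_closedInterior _ j hy), by rwa [hΩ.interior_eq]⟩
  -- a relatively interior point of the facet in `Ω`
  obtain ⟨x, hxΩ, hxj, hxpos⟩ : ∃ x ∈ Ω, bary (K i) j x = 0 ∧ ∀ k, k ≠ j → 0 < bary (K i) k x := by
    have hcont : Continuous fun t : ℝ => (AffineMap.lineMap y (facetCenter (K i) j) t : Pt d) :=
      AffineMap.lineMap_continuous
    have hev : ∀ᶠ t : ℝ in 𝓝[>] 0, (AffineMap.lineMap y (facetCenter (K i) j) t : Pt d) ∈ Ω := by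
      refine nhdsWithin_le_nhds (hcont.continuousAt.eventually_mem (hΩ.mem_nhds ?_))
      rwa [AffineMap.lineMap_apply_zero]
    have hIoo : ∀ᶠ t : ℝ in 𝓝[>] 0, t ∈ Set.Ioo (0 : ℝ) 1 := Ioo_mem_nhdsGT zero_lt_one
    obtain ⟨t, ht1, ht2⟩ := (hev.and hIoo).exists
    have hy' := (mem_facet_iff (K i)).1 hy
    refine ⟨_, ht1, ?_, fun k hk => ?_⟩
    · rw [bary_lineMap, hy'.1, bary_facetCenter, if_pos rfl]; ring
    · rw [bary_lineMap]
      exact add_pos_of_nonneg_of_pos (mul_nonneg (sub_pos.2 ht2.2).le (hy'.2 k))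
        (mul_pos ht2.1 (bary_facetCenter_pos _ hk))
  -- The negative parameter moves from `x` away from vertex `j`, out of `K i` but still inside `Ω`.
  -- As there are finitely many elements, a single one contains such points arbitrarily close to
  -- `x`.
  have hcont : Continuous fun t : ℝ => (AffineMap.lineMap x ((K i).points j) (-t) : Pt d) :=
    AffineMap.lineMap_continuous.comp continuous_neg
  have hev : ∀ᶠ t : ℝ in 𝓝[>] 0, (AffineMap.lineMap x ((K i).points j) (-t) : Pt d) ∈ Ω := by
    refine nhdsWithin_le_nhds (hcont.continuousAt.eventually_mem (hΩ.mem_nhds ?_))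
    simpa using hxΩ
  obtain ⟨i', hi'⟩ : ∃ i', ∃ᶠ t : ℝ in 𝓝[>] 0,
      (AffineMap.lineMap x ((K i).points j) (-t) : Pt d) ∈ (K i').closedInterior := by
    by_contra hcon
    push Not at hcon
    obtain ⟨t, ht1, ht2⟩ := (hev.and (eventually_all.2 hcon)).exists
    have := subset_closure ht1
    rw [← hK.cover] at this
    obtain ⟨i', hi'⟩ := Set.mem_iUnion.1 this
    exact ht2 i' hi'
  obtain ⟨t, ht, ht0⟩ := (hi'.and_eventually self_mem_nhdsWithin).exists
  have htK : (AffineMap.lineMap x ((K i).points j) (-t) : Pt d) ∉ (K i).closedInterior := by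
    intro hmem
    have := (mem_closedInterior_iff (K i)).1 hmem j
    rw [bary_lineMap, hxj, bary_point_self] at this
    have ht0' : 0 < t := ht0
    linarith
  have hxK' : x ∈ (K i').closedInterior := by
    refine (K i').isClosed_closedInterior.mem_of_frequently_of_tendsto hi' ?_
    have := (hcont.tendsto 0).mono_left (nhdsWithin_le_nhds (s := Set.Ioi 0))
    simpa using this
  have hne : i ≠ i' := by
    rintro rfl
    exact htK ht
  have hxK : x ∈ (K i).closedInterior := by
    refine (mem_closedInterior_iff _).2 fun k => ?_
    by_cases hk : k = j
    · rw [hk, hxj]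
    · exact (hxpos k hk).le
  have hx : x ∈ convexHull ℝ (Set.range (K i).points ∩ Set.range (K i').points) := by
    rw [← hK.conforming i i' hne]
    exact ⟨hxK, hxK'⟩
  -- By conformity `x` is in the hull of the common vertices. If a vertex `k ≠ j` were not common,
  -- coordinate `k` would vanish on that hull, whereas it is positive at `x`.
  have hsub1 : (K i).points '' {j}ᶜ ⊆ Set.range (K i').points := by
    rintro _ ⟨k, hk, rfl⟩
    by_contra hkn
    have hconv : Convex ℝ {z | bary (K i) k z = 0} :=
      (convex_singleton (0 : ℝ)).affine_preimage (bary (K i) k)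
    have hx0 : x ∈ {z | bary (K i) k z = 0} := by
      refine convexHull_min ?_ hconv hx
      rintro _ ⟨⟨l, rfl⟩, hl⟩
      refine bary_point_ne _ ?_
      rintro rfl
      exact hkn hl
    exact (hxpos k hk).ne' hx0
  -- If vertex `j` were common as well, the two simplices would coincide, but `K i'` contains a
  -- point outside `K i`.
  have hjn : (K i).points j ∉ Set.range (K i').points := by
    intro hj
    have hall : Set.range (K i).points ⊆ Set.range (K i').points := by
      rintro _ ⟨k, rfl⟩
      by_cases hk : k = j
      · rw [hk]; exact hj
      · exact hsub1 ⟨k, hk, rfl⟩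
    have heq := range_points_eq_of_subset hall
    have : (K i).closedInterior = (K i').closedInterior := by
      rw [← Affine.Simplex.convexHull_eq_closedInterior, heq,
        Affine.Simplex.convexHull_eq_closedInterior]
    exact htK (this ▸ ht)
  obtain ⟨j', hj'⟩ : ∃ j', (K i').points j' ∉ Set.range (K i).points := by
    by_contra hcon
    push Not at hcon
    have hall : Set.range (K i').points ⊆ Set.range (K i).points := by
      rintro _ ⟨k, rfl⟩
      exact hcon k
    exact hjn ((range_points_eq_of_subset hall).symm ▸ ⟨j, rfl⟩)
  refine ⟨i', j', hne, ?_⟩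
  rw [facet_eq_convexHull, facet_eq_convexHull]
  congr 1
  -- Both vertex sets have `d` elements, so one inclusion is enough.
  refine Set.eq_of_subset_of_ncard_le ?_ ?_ (Set.toFinite _)
  · rintro _ ⟨k, hk, rfl⟩
    obtain ⟨l, hl⟩ := hsub1 ⟨k, hk, rfl⟩
    refine ⟨l, ?_, hl⟩
    rintro rfl
    exact hj' (hl ▸ ⟨k, rfl⟩)
  · rw [Set.ncard_image_of_injective _ (K i).independent.injective,
      Set.ncard_image_of_injective _ (K i').independent.injective, Set.ncard_compl, Set.ncard_compl]
    simp

end MeshTopology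

/-! ### Integrability on elements and facets -/

section ElementIntegrability

variable {d : ℕ} [NeZero d] (s : Affine.Simplex ℝ (Pt d) d)

theorem restrict_interior_eq_restrict_closedInterior :
    (volume : Measure (Pt d)).restrict s.interior = volume.restrict s.closedInterior :=
  Measure.restrict_congr_set (closedInterior_ae_eq_interior s)

theorem memLp_restrict_closedInterior {E : Type*} [NormedAddCommGroup E] {f : Pt d → E}
    (hf : Continuous f) : MemLp f 2 (volume.restrict s.closedInterior) := by
  have hK : IsCompact s.closedInterior := s.isCompact_closedInterior
  have : IsFiniteMeasure (volume.restrict s.closedInterior) :=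
    ⟨by rw [Measure.restrict_apply_univ]; exact hK.measure_lt_top⟩
  obtain ⟨C, hC⟩ := hK.exists_bound_of_continuousOn hf.continuousOn
  exact MemLp.of_bound (hf.continuousOn.aestronglyMeasurable_of_isCompact hK hK.measurableSet) C
    ((ae_restrict_iff' hK.measurableSet).2 (Filter.Eventually.of_forall hC))

theorem memLp_indicator_interior {E : Type*} [NormedAddCommGroup E] {f : Pt d → E}
    (hf : Continuous f) : MemLp (s.interior.indicator f) 2 volume := by
  rw [memLp_indicator_iff_restrict (isOpen_simplexInterior s).measurableSet,
    restrict_interior_eq_restrict_closedInterior]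
  exact memLp_restrict_closedInterior s hf

theorem integrableOn_closedInterior {f : Pt d → ℝ} (hf : Continuous f) :
    IntegrableOn f s.closedInterior :=
  hf.continuousOn.integrableOn_compact s.isCompact_closedInterior

theorem integrableOn_facet_bdd_mul {g h : Pt d → ℝ} {j : Fin (d + 1)} (hg : Measurable g) {C : ℝ}
    (hC : ∀ x ∈ facet s j, |g x| ≤ C) (hh : Continuous h) :
    IntegrableOn (fun x => g x * h x) (facet s j) (surf d) :=
  (integrableOn_facet s j hh.continuousOn).bdd_mul (c := C) hg.aestronglyMeasurable
    ((ae_restrict_iff' (isCompact_facet s j).measurableSet).2 (Filter.Eventually.of_forall hC))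

end ElementIntegrability

/-! ### Uniqueness of the weak divergence -/

section WeakDivergence

variable {d : ℕ} {Ω : Set (Pt d)}

/-- The fundamental lemma of the calculus of variations, applied to `g₁ - g₂`. It lets the
conclusion speak of every weak divergence instead of a chosen one. -/
theorem HasWeakDiv.ae_eq (hΩ : IsOpen Ω) {v : Pt d → Pt d} {g₁ g₂ : Pt d → ℝ}
    (h₁ : HasWeakDiv Ω v g₁) (h₂ : HasWeakDiv Ω v g₂) : g₁ =ᵐ[volume.restrict Ω] g₂ := by
  have hloc : LocallyIntegrableOn (g₁ - g₂) Ω volume :=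
    locallyIntegrableOn_of_locallyIntegrable_restrict
      ((h₁.1.sub h₂.1).locallyIntegrable one_le_two)
  have hz := hΩ.ae_eq_zero_of_integral_contDiff_smul_eq_zero hloc fun φ hφ hc hs => by
    have hφ2 : MemLp φ 2 (volume.restrict Ω) :=
      (hφ.continuous.memLp_of_hasCompactSupport hc).restrict Ω
    have i₁ : Integrable (fun x => g₁ x * φ x) (volume.restrict Ω) := h₁.1.integrable_mul hφ2
    have i₂ : Integrable (fun x => g₂ x * φ x) (volume.restrict Ω) := h₂.1.integrable_mul hφ2
    have e : ∫ x in Ω, g₁ x * φ x = ∫ x in Ω, g₂ x * φ x := by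
      have e₁ := h₁.2 φ hφ hc hs
      have e₂ := h₂.2 φ hφ hc hs
      linarith
    rw [← setIntegral_eq_integral_of_forall_compl_eq_zero (s := Ω)]
    · calc ∫ x in Ω, φ x • (g₁ - g₂) x = ∫ x in Ω, g₁ x * φ x - g₂ x * φ x := by
            congr 1
            ext x
            simp only [Pi.sub_apply, smul_eq_mul]
            ring
        _ = 0 := by rw [integral_sub i₁ i₂, e, sub_self]
    · intro x hx
      rw [image_eq_zero_of_notMem_tsupport fun h => hx (hs h), zero_smul]
  rw [Filter.EventuallyEq, ae_restrict_iff' hΩ.measurableSet]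
  filter_upwards [hz] with x hx hxΩ
  exact sub_eq_zero.1 (hx hxΩ)

end WeakDivergence

/-! ### From elementwise to weak divergence -/

section Mesh

variable {d : ℕ} [NeZero d] {ι : Type*} {Ω ΓD ΓN : Set (Pt d)}
  {K : ι → Affine.Simplex ℝ (Pt d) d}

theorem IsMesh.interior_subset (hΩreg : interior (closure Ω) = Ω) (hK : IsMesh Ω K) (i : ι) :
    (K i).interior ⊆ Ω := by
  rw [← hΩreg, ← interior_closedInterior]
  exact interior_mono (hK.cover ▸ Set.subset_iUnion (fun i => (K i).closedInterior) i)

theorem IsMesh.memLp_closedInterior (hΩreg : interior (closure Ω) = Ω) (hK : IsMesh Ω K)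
    {f : Pt d → ℝ} (hf : MemLp f 2 (volume.restrict Ω)) (i : ι) :
    MemLp f 2 (volume.restrict (K i).closedInterior) := by
  rw [← restrict_interior_eq_restrict_closedInterior]
  exact hf.mono_measure (Measure.restrict_mono (hK.interior_subset hΩreg i) le_rfl)

/-- Facet contributions of a piecewise smooth field with continuous normal component cancel, when
tested with a function vanishing on the boundary. -/
theorem IsMesh.sum_integral_facet_eq_zero [Fintype ι] (hΩ : IsOpen Ω) (hK : IsMesh Ω K)
    {σ : ι → Pt d → Pt d} (hσ : ∀ i, Continuous (σ i))
    (hjump : ∀ i j i' j', IsInteriorFacet K i j i' j' → ∀ x ∈ facet (K i) j,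
      ⟪σ i x, normal (K i) j⟫ + ⟪σ i' x, normal (K i') j'⟫ = 0)
    {φ : Pt d → ℝ} (hφ : Continuous φ) (hφ0 : ∀ x ∈ frontier Ω, φ x = 0) :
    ∑ i, ∑ j, ∫ x in facet (K i) j, ⟪σ i x, normal (K i) j⟫ * φ x ∂(surf d) = 0 := by
  classical
  have hpartner : ∀ a : ι × Fin (d + 1), ∃ b : ι × Fin (d + 1),
      IsInteriorFacet K a.1 a.2 b.1 b.2 ∨
        (b = a ∧ ¬ ∃ i' j', IsInteriorFacet K a.1 a.2 i' j') := by
    intro a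
    by_cases h : ∃ i' j', IsInteriorFacet K a.1 a.2 i' j'
    · obtain ⟨i', j', h'⟩ := h
      exact ⟨(i', j'), Or.inl h'⟩
    · exact ⟨a, Or.inr ⟨rfl, h⟩⟩
  choose b hb using hpartner
  have hzero : ∀ a : ι × Fin (d + 1), (¬ ∃ i' j', IsInteriorFacet K a.1 a.2 i' j') →
      ∫ x in facet (K a.1) a.2, ⟪σ a.1 x, normal (K a.1) a.2⟫ * φ x ∂(surf d) = 0 := by
    intro a ha
    refine setIntegral_eq_zero_of_forall_eq_zero fun x hx => ?_
    rw [hφ0 x (not_imp_comm.1 (hK.exists_isInteriorFacet hΩ) ha hx), mul_zero]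
  have hpair : ∀ a b : ι × Fin (d + 1), IsInteriorFacet K a.1 a.2 b.1 b.2 →
      (∫ x in facet (K a.1) a.2, ⟪σ a.1 x, normal (K a.1) a.2⟫ * φ x ∂(surf d)) +
        ∫ x in facet (K b.1) b.2, ⟪σ b.1 x, normal (K b.1) b.2⟫ * φ x ∂(surf d) = 0 := by
    intro a b h
    rw [← h.2, ← integral_add]
    · refine setIntegral_eq_zero_of_forall_eq_zero fun x hx => ?_
      rw [← add_mul, hjump _ _ _ _ h x hx, zero_mul]
    · exact integrableOn_facet _ _ (((hσ _).inner continuous_const).mul hφ).continuousOn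
    · exact integrableOn_facet _ _ (((hσ _).inner continuous_const).mul hφ).continuousOn
  rw [← Fintype.sum_prod_type' (f := fun i j =>
    ∫ x in facet (K i) j, ⟪σ i x, normal (K i) j⟫ * φ x ∂(surf d))]
  -- Pair each side of a facet with the opposite side and let boundary sides be fixed points. Fixed
  -- points are admissible because their terms are zero, and uniqueness of the neighbour makes the
  -- pairing an involution.
  refine Finset.sum_involution (fun a _ => b a) ?_ ?_ (fun _ _ => Finset.mem_univ _) ?_
  · intro a _
    rcases hb a with h | ⟨h, h'⟩
    · exact hpair _ _ h
    · rw [h, hzero a h', add_zero]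
  · intro a _ hne heq
    rcases hb a with h | ⟨-, h'⟩
    · rw [heq] at h
      exact h.1 rfl
    · exact hne (hzero a h')
  · intro a _
    rcases hb a with h | ⟨h, -⟩
    · rcases hb (b a) with h2 | ⟨h2, h3⟩
      · have := hK.interiorFacet_unique h.symm h2
        exact Prod.ext this.1.symm this.2.symm
      · exact absurd ⟨_, _, h.symm⟩ h3
    · rw [h, h]

/-- A piecewise smooth field with continuous normal component has the piecewise divergence as its
weak divergence. -/
theorem IsMesh.hasWeakDiv_glue [Fintype ι] (hΩ : IsOpen Ω) (hΩreg : interior (closure Ω) = Ω)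
    (hK : IsMesh Ω K) {σ : ι → Pt d → Pt d} (hσ : ∀ i, ContDiff ℝ 1 (σ i))
    (hjump : ∀ i j i' j', IsInteriorFacet K i j i' j' → ∀ x ∈ facet (K i) j,
      ⟪σ i x, normal (K i) j⟫ + ⟪σ i' x, normal (K i') j'⟫ = 0) :
    HasWeakDiv Ω (glue K σ) (fun x => ∑ i, (K i).interior.indicator (divergence (σ i)) x) := by
  refine ⟨memLp_finsetSum _ fun i _ =>
    (memLp_indicator_interior _ (continuous_divergence (hσ i))).restrict Ω, fun φ hφ hc hs => ?_⟩
  have hφ1 : ContDiff ℝ 1 φ := hφ.of_le (by norm_cast)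
  have hset : ∀ (i : ι) (F : Pt d → ℝ),
      ∫ x in Ω, (K i).interior.indicator F x = ∫ x in (K i).closedInterior, F x := by
    intro i F
    rw [setIntegral_indicator (isOpen_simplexInterior _).measurableSet,
      Set.inter_eq_right.2 (hK.interior_subset hΩreg i),
      restrict_interior_eq_restrict_closedInterior]
  have hsum : ∀ F : ι → Pt d → ℝ, (∀ i, Continuous (F i)) →
      ∫ x in Ω, ∑ i, (K i).interior.indicator (F i) x =
        ∑ i, ∫ x in (K i).closedInterior, F i x := by
    intro F hF
    rw [integral_finsetSum]
    · exact Finset.sum_congr rfl fun i _ => hset i (F i)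
    · intro i _
      refine Integrable.restrict ?_
      rw [integrable_indicator_iff (isOpen_simplexInterior _).measurableSet]
      unfold IntegrableOn
      rw [restrict_interior_eq_restrict_closedInterior]
      exact integrableOn_closedInterior _ (hF i)
  have e1 : ∫ x in Ω, ⟪glue K σ x, gradient φ x⟫ =
      ∑ i, ∫ x in (K i).closedInterior, ⟪σ i x, gradient φ x⟫ := by
    rw [← hsum _ fun i => (hσ i).continuous.inner (continuous_gradient hφ1)]
    congr 1
    ext x
    rw [glue, sum_inner]
    refine Finset.sum_congr rfl fun i _ => ?_
    by_cases hx : x ∈ (K i).interior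
    · simp [hx]
    · simp [hx]
  have e2 : ∫ x in Ω, (∑ i, (K i).interior.indicator (divergence (σ i)) x) * φ x =
      ∑ i, ∫ x in (K i).closedInterior, divergence (σ i) x * φ x := by
    rw [← hsum (fun i x => divergence (σ i) x * φ x)
      fun i => (continuous_divergence (hσ i)).mul hφ.continuous]
    congr 1
    ext x
    rw [Finset.sum_mul]
    refine Finset.sum_congr rfl fun i _ => ?_
    by_cases hx : x ∈ (K i).interior
    · simp [hx]
    · simp [hx]
  rw [e1, e2, eq_neg_iff_add_eq_zero, ← Finset.sum_add_distrib,
    ← hK.sum_integral_facet_eq_zero hΩ (fun i => (hσ i).continuous) hjump hφ.continuous]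
  · exact Finset.sum_congr rfl fun i _ =>
      integral_inner_gradient_add_divergence (K i) (hσ i) hφ1
  · intro x hx
    refine image_eq_zero_of_notMem_tsupport fun h => ?_
    exact (hΩ.frontier_eq ▸ hx).2 (hs h)

theorem memHDiv_glue [Fintype ι] {σ : ι → Pt d → Pt d} (hσ : ∀ i, Continuous (σ i))
    {g : Pt d → ℝ} (hg : HasWeakDiv Ω (glue K σ) g) : MemHDiv Ω (glue K σ) :=
  ⟨memLp_finsetSum _ fun i _ => (memLp_indicator_interior _ (hσ i)).restrict Ω, g, hg⟩

theorem IsMesh.sum_indicator_interior [Fintype ι] (hK : IsMesh Ω K) (F : ι → Pt d → ℝ) {i : ι}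
    {x : Pt d} (hx : x ∈ (K i).interior) : ∑ i', (K i').interior.indicator (F i') x = F i x := by
  rw [Finset.sum_eq_single i]
  · exact Set.indicator_of_mem hx _
  · intro i' _ hne
    exact Set.indicator_of_notMem
      (fun h => Set.disjoint_left.1 (hK.nonoverlapping i' i hne) h hx) _
  · simp

end Mesh

/-! ### Properties of the post-processed flux -/

section PostprocessedFlux

variable {d : ℕ} [NeZero d] {ι : Type*} {Ω ΓD ΓN : Set (Pt d)}
  {K : ι → Affine.Simplex ℝ (Pt d) d} {p : ℕ} {ν f gD gN : Pt d → ℝ}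
  {τ : ι → Fin (d + 1) → Pt d → ℝ} {u : ι → Pt d → ℝ} {q σ : ι → Pt d → Pt d}
  {uhat : ι → Fin (d + 1) → Pt d → ℝ} {qhat : ι → Fin (d + 1) → Pt d → Pt d}

theorem projFacet_isPoly (s : Affine.Simplex ℝ (Pt d) d) (j : Fin (d + 1)) (p : ℕ)
    (g : Pt d → ℝ) : IsPoly p (projFacet s j p g) := l2Proj_isPoly _ _ _

/-- The numerical flux of the HDG method is single-valued on interior facets. -/
theorem IsHDGSolution.qhat_eq (hHDG : IsHDGSolution Ω ΓD ΓN K p ν f gD gN τ u q uhat qhat)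
    {i i' : ι} {j j' : Fin (d + 1)} (h : IsInteriorFacet K i j i' j') {x : Pt d}
    (hx : x ∈ facet (K i) j) : qhat i j x = qhat i' j' x := by
  rw [hHDG.qhat_interior _ _ _ _ h x hx, hHDG.qhat_interior _ _ _ _ h.symm x (h.2 ▸ hx),
    add_comm (τ i' j' x), mul_comm (τ i' j' x), add_comm (u i' x • _)]
  abel

/-- The normal component of the numerical flux is integrable against continuous functions. -/
theorem IsHDGSolution.integrableOn_qhat [Finite ι] (hΩ : IsOpen Ω) (hK : IsMesh Ω K)
    (hΓ : IsBoundarySplit Ω ΓD ΓN K) (hτmeas : ∀ i j, Measurable (τ i j))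
    (hτ : ∃ c C : ℝ, 0 < c ∧ ∀ i j, ∀ x ∈ facet (K i) j, c ≤ τ i j x ∧ τ i j x ≤ C)
    (hHDG : IsHDGSolution Ω ΓD ΓN K p ν f gD gN τ u q uhat qhat) (i : ι) (j : Fin (d + 1))
    {w : Pt d → ℝ} (hw : Continuous w) :
    IntegrableOn (fun x => ⟪qhat i j x, normal (K i) j⟫ * w x) (facet (K i) j) (surf d) := by
  obtain ⟨c, C, hc, hτ⟩ := hτ
  have hF := (isCompact_facet (K i) j).measurableSet
  have hq : ∀ i, Continuous (q i) := fun i => ((hHDG.q_poly i).contDiff (n := 0)).continuous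
  have hu : ∀ i, Continuous (u i) := fun i => (hHDG.u_poly i).continuous
  have hpD := (projFacet_isPoly (K i) j p gD).continuous
  have hpN := (projFacet_isPoly (K i) j p gN).continuous
  by_cases hfr : facet (K i) j ⊆ frontier Ω
  · rcases hΓ.resolved i j hfr with hD | hN
    · have h1 : IntegrableOn (fun x => ⟪q i x, normal (K i) j⟫ * w x) (facet (K i) j) (surf d) :=
        integrableOn_facet _ _ (((hq i).inner continuous_const).mul hw).continuousOn
      have h2 : IntegrableOn (fun x => τ i j x * ((u i x - projFacet (K i) j p gD x) * w x))
          (facet (K i) j) (surf d) :=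
        integrableOn_facet_bdd_mul _ (hτmeas i j)
          (fun x hx => abs_le.2 ⟨by linarith [hτ i j x hx], (hτ i j x hx).2⟩)
          (((hu i).sub hpD).mul hw)
      refine (integrableOn_congr_fun (fun x hx => ?_) hF).2 (h1.add h2)
      simp only [Pi.add_apply]
      rw [hHDG.qhat_dirichlet i j hD x hx]
      ring
    · have h1 : IntegrableOn (fun x => projFacet (K i) j p gN x * w x) (facet (K i) j) (surf d) :=
        integrableOn_facet _ _ (hpN.mul hw).continuousOn
      refine (integrableOn_congr_fun (fun x hx => ?_) hF).2 h1
      rw [hHDG.qhat_neumann i j hN x hx]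
  · obtain ⟨i', j', h⟩ := hK.exists_isInteriorFacet hΩ hfr
    have hm := hτmeas i j
    have hm' := hτmeas i' j'
    have hpos : ∀ x ∈ facet (K i) j, 0 < τ i j x ∧ 0 < τ i' j' x ∧ τ i j x ≤ C := fun x hx =>
      ⟨hc.trans_le (hτ i j x hx).1, hc.trans_le (hτ i' j' x (h.2 ▸ hx)).1, (hτ i j x hx).2⟩
    have h1 : IntegrableOn (fun x => τ i' j' x / (τ i j x + τ i' j' x) *
        (⟪q i x, normal (K i) j⟫ * w x)) (facet (K i) j) (surf d) := by
      refine integrableOn_facet_bdd_mul _ (hm'.div (hm.add hm')) (C := 1) (fun x hx => ?_)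
        (((hq i).inner continuous_const).mul hw)
      obtain ⟨ha, hb, -⟩ := hpos x hx
      rw [abs_of_pos (by positivity), div_le_one (by positivity)]
      linarith
    have h2 : IntegrableOn (fun x => τ i j x / (τ i j x + τ i' j' x) *
        (⟪q i' x, normal (K i) j⟫ * w x)) (facet (K i) j) (surf d) := by
      refine integrableOn_facet_bdd_mul _ (hm.div (hm.add hm')) (C := 1) (fun x hx => ?_)
        (((hq i').inner continuous_const).mul hw)
      obtain ⟨ha, hb, -⟩ := hpos x hx
      rw [abs_of_pos (by positivity), div_le_one (by positivity)]
      linarith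
    have h3 : IntegrableOn (fun x => τ i j x * τ i' j' x / (τ i j x + τ i' j' x) *
        (⟪u i x • normal (K i) j + u i' x • normal (K i') j', normal (K i) j⟫ * w x))
        (facet (K i) j) (surf d) := by
      refine integrableOn_facet_bdd_mul _ ((hm.mul hm').div (hm.add hm')) (C := C)
        (fun x hx => ?_) (((((hu i).smul continuous_const).add
          ((hu i').smul continuous_const)).inner continuous_const).mul hw)
      obtain ⟨ha, hb, hC⟩ := hpos x hx
      rw [abs_of_pos (by positivity), div_le_iff₀ (by positivity)]
      -- `τ τ' ≤ C (τ + τ')`, from `τ ≤ C` and positivity of both.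
      nlinarith
    refine (integrableOn_congr_fun (fun x hx => ?_) hF).2 ((h1.add h2).add h3)
    simp only [Pi.add_apply]
    rw [hHDG.qhat_interior _ _ _ _ h x hx, inner_add_left, inner_add_left, real_inner_smul_left,
      real_inner_smul_left, real_inner_smul_left]
    ring

/-- The facet moments of the post-processed flux are those of the numerical flux. -/
theorem IsPostprocessedFlux.integral_facet_eq (hσ : IsPostprocessedFlux K p q qhat σ)
    {i : ι} {j : Fin (d + 1)} {w : Pt d → ℝ} (hw : IsPoly p w)
    (hint : IntegrableOn (fun x => ⟪qhat i j x, normal (K i) j⟫ * w x) (facet (K i) j) (surf d)) :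
    ∫ x in facet (K i) j, ⟪σ i x, normal (K i) j⟫ * w x ∂(surf d) =
      ∫ x in facet (K i) j, ⟪qhat i j x, normal (K i) j⟫ * w x ∂(surf d) := by
  have hs : Continuous (σ i) := ((hσ.raviartThomas i).contDiff (n := 0)).continuous
  have h := hσ.facet_moments i j w hw
  simp only [inner_sub_left, sub_mul] at h
  have hint' : IntegrableOn (fun x => ⟪σ i x, normal (K i) j⟫ * w x) (facet (K i) j) (surf d) :=
    integrableOn_facet _ _ ((hs.inner continuous_const).mul hw.continuous).continuousOn
  -- Splitting the moment of the difference requires the numerical flux itself to be integrable;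
  -- this is what the bounds on `τ` provide through `IsHDGSolution.integrableOn_qhat`.
  rw [integral_sub hint' hint] at h
  exact sub_eq_zero.1 h

/-- The gradient of `w` is an admissible test field in the element moments when `p ≥ 1`; for `p = 0`
both integrands vanish. -/
theorem IsPostprocessedFlux.integral_inner_gradient (hσ : IsPostprocessedFlux K p q qhat σ)
    (hq : ∀ i, IsPolyVec p (q i)) (i : ι) {w : Pt d → ℝ} (hw : IsPoly p w) :
    ∫ x in (K i).closedInterior, ⟪σ i x, gradient w x⟫ =
      ∫ x in (K i).closedInterior, ⟪q i x, gradient w x⟫ := by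
  rcases Nat.eq_zero_or_pos p with rfl | hp
  · simp only [hw.gradient_eq_zero, inner_zero_right]
  · have hs : Continuous (σ i) := ((hσ.raviartThomas i).contDiff (n := 0)).continuous
    have hg := continuous_gradient (hw.contDiff (n := 1))
    have h := hσ.element_moments hp i _ hw.gradient
    simp only [inner_sub_left] at h
    rw [integral_sub (integrableOn_closedInterior _ (hs.inner hg))
      (integrableOn_closedInterior _ (((hq i).contDiff (n := 0)).continuous.inner hg))] at h
    exact sub_eq_zero.1 h

/-- Local conservation: the divergence of the post-processed flux is the projected source. -/
theorem IsPostprocessedFlux.divergence_ae_eq [Finite ι] (hΩ : IsOpen Ω)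
    (hΩreg : interior (closure Ω) = Ω) (hK : IsMesh Ω K)
    (hΓ : IsBoundarySplit Ω ΓD ΓN K) (hf : MemLp f 2 (volume.restrict Ω))
    (hτmeas : ∀ i j, Measurable (τ i j))
    (hτ : ∃ c C : ℝ, 0 < c ∧ ∀ i j, ∀ x ∈ facet (K i) j, c ≤ τ i j x ∧ τ i j x ≤ C)
    (hHDG : IsHDGSolution Ω ΓD ΓN K p ν f gD gN τ u q uhat qhat)
    (hσ : IsPostprocessedFlux K p q qhat σ) (i : ι) :
    divergence (σ i) =ᵐ[volume.restrict (K i).closedInterior] projElt (K i) p f := by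
  have hμ : ∀ w : Pt d → ℝ, IsPoly p w → MemLp w 2 (volume.restrict (K i).closedInterior) :=
    fun w hw => memLp_restrict_closedInterior _ hw.continuous
  have hfK := hK.memLp_closedInterior hΩreg hf i
  -- By uniqueness of the projection it suffices that `div σ` lies in `ℙ^p` and has the moments of
  -- `f`.
  refine IsL2Proj.ae_eq hμ hfK ⟨(hσ.raviartThomas i).isPoly_divergence, fun w hw => ?_⟩
    (l2Proj_spec _ p f hμ hfK)
  have hdiv := (hσ.raviartThomas i).isPoly_divergence
  have i₁ : Integrable (fun x => f x * w x) (volume.restrict (K i).closedInterior) :=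
    hfK.integrable_mul (hμ w hw)
  have i₂ : Integrable (fun x => divergence (σ i) x * w x)
      (volume.restrict (K i).closedInterior) := (hμ _ hdiv).integrable_mul (hμ w hw)
  simp only [sub_mul]
  rw [integral_sub i₁ i₂, ← hHDG.eq_balance i w hw,
    ← hσ.integral_inner_gradient hHDG.q_poly i hw]
  have hparts := integral_inner_gradient_add_divergence (K i)
    ((hσ.raviartThomas i).contDiff (n := 1)) (hw.contDiff (n := 1))
  rw [Finset.sum_congr rfl fun j _ => hσ.integral_facet_eq (j := j) hw
    (hHDG.integrableOn_qhat hΩ hK hΓ hτmeas hτ i j hw.continuous)] at hparts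
  linarith

/-- The normal component of the post-processed flux is continuous across interior facets. -/
theorem IsPostprocessedFlux.normal_add_normal_eq_zero [Finite ι] (hΩ : IsOpen Ω)
    (hK : IsMesh Ω K) (hΓ : IsBoundarySplit Ω ΓD ΓN K) (hτmeas : ∀ i j, Measurable (τ i j))
    (hτ : ∃ c C : ℝ, 0 < c ∧ ∀ i j, ∀ x ∈ facet (K i) j, c ≤ τ i j x ∧ τ i j x ≤ C)
    (hHDG : IsHDGSolution Ω ΓD ΓN K p ν f gD gN τ u q uhat qhat)
    (hσ : IsPostprocessedFlux K p q qhat σ) {i i' : ι} {j j' : Fin (d + 1)}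
    (h : IsInteriorFacet K i j i' j') {x : Pt d} (hx : x ∈ facet (K i) j) :
    ⟪σ i x, normal (K i) j⟫ + ⟪σ i' x, normal (K i') j'⟫ = 0 := by
  obtain ⟨π, hπ, hπ'⟩ := (hσ.raviartThomas i).exists_isPoly_inner (normal (K i) j)
    ((K i).altitudeFoot j)
  obtain ⟨ρ, hρ, hρ'⟩ := (hσ.raviartThomas i').exists_isPoly_inner (normal (K i') j')
    ((K i').altitudeFoot j')
  have hπF : ∀ y ∈ facet (K i) j, ⟪σ i y, normal (K i) j⟫ = π y := fun y hy =>
    hπ' y (facet_subset_facetPlane _ _ hy)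
  have hρF : ∀ y ∈ facet (K i') j', ⟪σ i' y, normal (K i') j'⟫ = ρ y := fun y hy =>
    hρ' y (facet_subset_facetPlane _ _ hy)
  rw [hπF x hx, hρF x (h.2 ▸ hx)]
  refine (hπ.add hρ).eq_zero_on_facet (K i) (j := j) (fun w hw => ?_) x hx
  have hF := (isCompact_facet (K i) j).measurableSet
  have hF' := (isCompact_facet (K i') j').measurableSet
  have e1 : ∫ y in facet (K i) j, π y * w y ∂(surf d) =
      ∫ y in facet (K i) j, ⟪qhat i j y, normal (K i) j⟫ * w y ∂(surf d) := by
    rw [← hσ.integral_facet_eq hw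
      (hHDG.integrableOn_qhat hΩ hK hΓ hτmeas hτ i j hw.continuous)]
    exact setIntegral_congr_fun hF fun y hy => by simp only [hπF y hy]
  have e2 : ∫ y in facet (K i) j, ρ y * w y ∂(surf d) =
      -∫ y in facet (K i) j, ⟪qhat i j y, normal (K i) j⟫ * w y ∂(surf d) := by
    have e3 := hσ.integral_facet_eq hw
      (hHDG.integrableOn_qhat hΩ hK hΓ hτmeas hτ i' j' hw.continuous)
    rw [setIntegral_congr_fun hF' fun y hy => by simp only [hρF y hy]; rfl] at e3
    rw [h.2, e3, ← integral_neg]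
    refine setIntegral_congr_fun hF' fun y hy => ?_
    -- Seen from the other element, the numerical flux is the same and the normal is reversed.
    rw [hHDG.qhat_eq h (h.2 ▸ hy), hK.normal_eq_neg h, inner_neg_right, neg_mul]
  simp only [add_mul]
  rw [integral_add, e1, e2, add_neg_cancel]
  · exact integrableOn_facet _ _ (hπ.continuous.mul hw.continuous).continuousOn
  · exact integrableOn_facet _ _ (hρ.continuous.mul hw.continuous).continuousOn

/-- On a Neumann facet the numerical flux is already a polynomial, so the facet moment with `w` is
literally the moment of a polynomial difference and no splitting is needed. -/
theorem IsPostprocessedFlux.inner_normal_neumann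
    (hHDG : IsHDGSolution Ω ΓD ΓN K p ν f gD gN τ u q uhat qhat)
    (hσ : IsPostprocessedFlux K p q qhat σ) {i : ι} {j : Fin (d + 1)}
    (h : IsBoundaryFacet Ω ΓN (K i) j) {x : Pt d} (hx : x ∈ facet (K i) j) :
    ⟪σ i x, normal (K i) j⟫ = projFacet (K i) j p gN x := by
  obtain ⟨π, hπ, hπ'⟩ := (hσ.raviartThomas i).exists_isPoly_inner (normal (K i) j)
    ((K i).altitudeFoot j)
  have hπF : ∀ y ∈ facet (K i) j, ⟪σ i y, normal (K i) j⟫ = π y := fun y hy =>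
    hπ' y (facet_subset_facetPlane _ _ hy)
  rw [hπF x hx]
  refine sub_eq_zero.1 ((hπ.sub (projFacet_isPoly (K i) j p gN)).eq_zero_on_facet (K i) (j := j)
    (fun w hw => ?_) x hx)
  rw [← hσ.facet_moments i j w hw]
  refine setIntegral_congr_fun (isCompact_facet (K i) j).measurableSet fun y hy => ?_
  rw [inner_sub_left, hπF y hy, hHDG.qhat_neumann i j h y hy]

end PostprocessedFlux

end HDG

/-! ### The equilibration conditions -/

theorem mainTheorem5 {d : ℕ} [NeZero d] (hd : d = 2 ∨ d = 3) {ι : Type*} [Fintype ι]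
    (Ω ΓD ΓN : Set (Pt d))
    (hΩ : IsOpen Ω) (hΩconn : IsConnected Ω) (hΩreg : interior (closure Ω) = Ω)
    (K : ι → Affine.Simplex ℝ (Pt d) d) (hK : IsMesh Ω K)
    (hΓ : IsBoundarySplit Ω ΓD ΓN K)
    (ν f gD gN : Pt d → ℝ)
    (hνpos : ∀ x ∈ Ω, 0 < ν x)
    (hνconst : ∀ i, ∃ c : ℝ, ∀ x ∈ (K i).interior, ν x = c)
    (hf : MeasureTheory.MemLp f 2 (MeasureTheory.volume.restrict Ω))
    (hgD : ContinuousOn gD ΓD) (hgD2 : MeasureTheory.MemLp gD 2 ((surf d).restrict ΓD))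
    (hgN : MeasureTheory.MemLp gN 2 ((surf d).restrict ΓN))
    (τ : ι → Fin (d + 1) → Pt d → ℝ)
    (hτmeas : ∀ i j, Measurable (τ i j))
    (hτ : ∃ c C : ℝ, 0 < c ∧ ∀ i j, ∀ x ∈ facet (K i) j, c ≤ τ i j x ∧ τ i j x ≤ C)
    (p : ℕ)
    (u : ι → Pt d → ℝ) (q : ι → Pt d → Pt d)
    (uhat : ι → Fin (d + 1) → Pt d → ℝ) (qhat : ι → Fin (d + 1) → Pt d → Pt d)
    (hHDG : IsHDGSolution Ω ΓD ΓN K p ν f gD gN τ u q uhat qhat)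
    (σ : ι → Pt d → Pt d)
    (hσ : IsPostprocessedFlux K p q qhat σ) :
    IsProjectedEquilibratedFlux Ω ΓN K f gN p p σ := by
  have hC : ∀ i, ContDiff ℝ 1 (σ i) := fun i => (hσ.raviartThomas i).contDiff
  have hdiv := hσ.divergence_ae_eq hΩ hΩreg hK hΓ hf hτmeas hτ hHDG
  have hweak := hK.hasWeakDiv_glue hΩ hΩreg hC fun i j i' j' h x hx =>
    hσ.normal_add_normal_eq_zero hΩ hK hΓ hτmeas hτ hHDG h hx
  refine ⟨memHDiv_glue (fun i => (hC i).continuous) hweak, fun g hg i => ?_,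
    fun i j h x hx => hσ.inner_normal_neumann hHDG h hx⟩
  refine Filter.EventuallyEq.trans ?_ (hdiv i)
  have hsub := hK.interior_subset hΩreg i
  -- Any weak divergence agrees a.e. with the piecewise one, which on an open element is `div σ`
  -- alone; the element's boundary is a null set.
  have hae := ae_restrict_of_ae_restrict_of_subset hsub (hg.ae_eq hΩ hweak)
  rw [← restrict_interior_eq_restrict_closedInterior]
  filter_upwards [hae, ae_restrict_mem (isOpen_simplexInterior (K i)).measurableSet] with x hx hxi
  rw [hx, hK.sum_indicator_interior (fun i => divergence (σ i)) hxi]
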